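/- Let $(\Lambda,\mathcal E)$ be a finite graph (no self-edges, no multiple edges), $\beta>0$, $u\in[0,1]$, $S\in\frac12\mathbb N$, $x,y\in\Lambda$ and $t\in[0,\beta]$. \emph{Quantum model.} On $\mathcal H_\Lambda=\bigotimes_{x\in\Lambda}\mathbb C^{2S+1}$ let $S^1,S^2,S^3$ be the usual spin-$S$ matrices in the basis $|a\rangle$, $a\in\{-S,\dots,S\}$: $S^3|a\rangle=a|a\rangle$, $S^+|a\rangle=\sqrt{S(S+1)-a(a+1)}\,|a+1\rangle$, $S^-=(S^+)^*$, $S^1=\frac12(S^++S^-)$, $S^2=\frac1{2\mathrm i}(S^+-S^-)$. Let $S^i_x=S^i\otimes\mathrm{Id}_{\Lambda\setminus\{x\}}$. Let $T_{xy}|a,b\rangle=|b,a\rangle$ and $\langle a,b|Q_{xy}|c,d\rangle=\delta_{a,b}\delta_{c,d}$ (acting as the identity on the other sites), and $$H^{(u)}_\Lambda=-\sum_{\{x,y\}\in\mathcal E}\bigl(uT_{xy}+(1-u)Q_{xy}-1\bigr),\qquad \langle A;B\rangle(t)=\frac{\operatorname{Tr}A\,\mathrm e^{-(\beta-t)H^{(u)}_\Lambda}B\,\mathrm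 e^{-tH^{(u)}_\Lambda}}{\operatorname{Tr}\mathrm e^{-\beta H^{(u)}_\Lambda}}.$$ \emph{Loop model.} Let $\rho_u$ be the law of the Poisson point process on $\mathcal E\times[0,\beta]$ with crosses at intensity $u$ and double bars at intensity $1-u$. A realization $\omega$ decomposes $\Lambda\times[0,\beta]$, with the times $0$ and $\beta$ identified, into a finite set $\mathcal L(\omega)$ of loops: a trajectory moves vertically until it meets a transition at its site; at a cross on $\{x,y\}$ it goes across the edge and continues in the same vertical direction, at a double bar it goes across and continues in the opposite vertical direction; loops are considered without orientation or parametrization. Let $\mathbb P$ be the probability measure proportional to $(2S+1)^{|\mathcal L(\omega)|}\,\mathrm d\rho_u(\omega)$. Let $E^+_{x,y,t}$ (resp. $E^-_{x,y,t}$) be the event that $(x,0)$ and $(y,t)$ belong to the same loop, which has identical (resp. opposite) vertical directions at these two points, and $E_{x,y,t}=E^+_{x,y,t}\cup E^-_{x,y,t}$. \emph{Theorem.} Then $$\langle S^1_x;S^1_y\rangle(t)=\langle S^3_x;S^3_y\rangle(t)=\tfrac13S(S+1)\,\mathbb P(E_{x,y,t}),$$ $$\langle S^2_x;S^2_y\rangle(t)=\tfrac13S(S+1)\bigl[\mathbb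 P(E^+_{x,y,t})-\mathbb P(E^-_{x,y,t})\bigr].$$ -/

import Mathlib

open MeasureTheory Set

noncomputable section

namespace LoopSpin

/-! ### Poisson point processes of crosses and double bars -/

/-- Finite configurations of points of `X`. -/
def Config (X : Type*) : Type _ := Finset X

open Classical in
/-- The finite set of points that occur in a finite sequence of points. -/
def Config.ofSeq {X : Type*} {k : ℕ} (p : Fin k → X) : Config X :=
  (Finset.univ.image p : Finset X)

instance {X : Type*} : Membership X (Config X) := ⟨fun ω m => m ∈ (show Finset X from ω)⟩

/-- The σ-algebra inherited from that of `X`: a set of configurations is measurable if, for every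
`k`, the set of all sequences of `k` points whose configuration belongs to it is measurable
in `X ^ k`. -/
instance {X : Type*} [MeasurableSpace X] : MeasurableSpace (Config X) :=
  ⨅ k : ℕ, MeasurableSpace.map (fun p : Fin k → X => Config.ofSeq p) inferInstance

/-- The law of the Poisson point process with finite intensity measure `ν` without atoms:
`∫ F dρ = exp (-ν(X)) ∑_k (1 / k!) ∫ F({p₁, …, p_k}) dν(p₁) ⋯ dν(p_k)`. -/
def poissonProcess {X : Type*} [MeasurableSpace X] (ν : Measure X) : Measure (Config X) :=
  Measure.sum fun k : ℕ =>
    ENNReal.ofReal (Real.exp (-(ν univ).toReal) / (k.factorial : ℝ)) •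
      (Measure.pi fun _ : Fin k => ν).map fun p => Config.ofSeq p

/-- The two kinds of events of the process. -/
inductive Kind : Type
  | cross
  | bar

instance : MeasurableSpace Kind := ⊤

variable {Λ : Type*}

instance (G : SimpleGraph Λ) : MeasurableSpace G.edgeSet := ⊤

/-- A transition: an edge, a time, and the kind of event (cross or double bar). -/
abbrev Transition (G : SimpleGraph Λ) : Type _ := G.edgeSet × ℝ × Kind

/-- Counting measure on the edges, Lebesgue measure on `[0, β]`, and weights `u` for the crosses
and `1 - u` for the double bars. -/
def intensity (G : SimpleGraph Λ) (β u : ℝ) : Measure (Transition G) :=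
  (Measure.count : Measure G.edgeSet).prod
    ((volume.restrict (Icc 0 β)).prod
      (ENNReal.ofReal u • Measure.dirac Kind.cross +
        ENNReal.ofReal (1 - u) • Measure.dirac Kind.bar))

/-- The measure `ρ_u` of the Poisson process of crosses (intensity `u`) and double bars
(intensity `1 - u`) on `edges × [0, β]`. -/
def rho (G : SimpleGraph Λ) (β u : ℝ) : Measure (Config (Transition G)) :=
  poissonProcess (intensity G β u)

/-! ### Loops -/

/-- The two vertical directions. -/
inductive Dir : Type
  | up
  | down

/-- A space-time point together with a vertical direction of motion. -/
structure OrientedPoint (Λ : Type*) : Type _ where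
  site : Λ
  time : ℝ
  dir : Dir

section Loops

variable {G : SimpleGraph Λ}

/-- No transition of `ω` on an edge containing `x` occurs at a time in `I`. -/
def Free (ω : Config (Transition G)) (x : Λ) (I : Set ℝ) : Prop :=
  ∀ m ∈ ω, x ∈ (m.1 : Sym2 Λ) → m.2.1 ∉ I

/-- `ω` has a transition of kind `κ` between `x` and `y` at time `r`. -/
def HasTransition (ω : Config (Transition G)) (κ : Kind) (x y : Λ) (r : ℝ) : Prop :=
  ∃ m ∈ ω, (m.1 : Sym2 Λ) = s(x, y) ∧ m.2.1 = r ∧ m.2.2 = κ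

/-- Pieces of trajectories in `Λ × [0, β]`, where the times `0` and `β` are identified: the
trajectory moves vertically as long as no transition is met. When a cross is met, it goes across
and continues in the same vertical direction; when a double bar is met, it goes across and
continues in the opposite vertical direction. -/
inductive Move (β : ℝ) (ω : Config (Transition G)) : OrientedPoint Λ → OrientedPoint Λ → Prop
  | up {x : Λ} {s s' : ℝ} (h₀ : 0 ≤ s) (h : s ≤ s') (h₁ : s' ≤ β) (hx : Free ω x (Icc s s')) :
      Move β ω ⟨x, s, .up⟩ ⟨x, s', .up⟩
  | down {x : Λ} {s s' : ℝ} (h₀ : 0 ≤ s') (h : s' ≤ s) (h₁ : s ≤ β) (hx : Free ω x (Icc s' s)) :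
      Move β ω ⟨x, s, .down⟩ ⟨x, s', .down⟩
  | wrapUp {x : Λ} (hx : Free ω x {0, β}) : Move β ω ⟨x, β, .up⟩ ⟨x, 0, .up⟩
  | wrapDown {x : Λ} (hx : Free ω x {0, β}) : Move β ω ⟨x, 0, .down⟩ ⟨x, β, .down⟩
  | crossUp {x y : Λ} {s r s' : ℝ} (hr : HasTransition ω .cross x y r)
      (h₀ : 0 ≤ s) (h : s < r) (h' : r < s') (h₁ : s' ≤ β)
      (hx : Free ω x (Ico s r)) (hy : Free ω y (Ioc r s')) :
      Move β ω ⟨x, s, .up⟩ ⟨y, s', .up⟩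
  | crossDown {x y : Λ} {s r s' : ℝ} (hr : HasTransition ω .cross x y r)
      (h₀ : 0 ≤ s') (h' : s' < r) (h : r < s) (h₁ : s ≤ β)
      (hx : Free ω x (Ioc r s)) (hy : Free ω y (Ico s' r)) :
      Move β ω ⟨x, s, .down⟩ ⟨y, s', .down⟩
  | barUp {x y : Λ} {s r s' : ℝ} (hr : HasTransition ω .bar x y r) (hβ : r ≤ β)
      (h₀ : 0 ≤ s) (h : s < r) (h₀' : 0 ≤ s') (h' : s' < r)
      (hx : Free ω x (Ico s r)) (hy : Free ω y (Ico s' r)) :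
      Move β ω ⟨x, s, .up⟩ ⟨y, s', .down⟩
  | barDown {x y : Λ} {s r s' : ℝ} (hr : HasTransition ω .bar x y r) (hβ : 0 ≤ r)
      (h : r < s) (h₁ : s ≤ β) (h' : r < s') (h₁' : s' ≤ β)
      (hx : Free ω x (Ioc r s)) (hy : Free ω y (Ioc r s')) :
      Move β ω ⟨x, s, .down⟩ ⟨y, s', .up⟩

/-- The two oriented points lie on the same trajectory, with their directions given by a common
orientation of this trajectory. -/
def SameTrajectory (β : ℝ) (ω : Config (Transition G)) (a b : OrientedPoint Λ) : Prop :=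
  Relation.EqvGen (Move β ω) a b

/-- The points of `Λ × [0, β]` that are not in the support of `ω`. -/
def regularPoints (β : ℝ) (ω : Config (Transition G)) : Set (Λ × ℝ) :=
  {p | p.2 ∈ Icc 0 β ∧ Free ω p.1 {p.2}}

/-- The loop containing `p`, without orientation or parametrization: the set of the regular points
that the trajectory started at `p` in the direction `up` visits in one of the two directions. -/
def loopThrough (β : ℝ) (ω : Config (Transition G)) (p : Λ × ℝ) : Set (Λ × ℝ) :=
  {q | q ∈ regularPoints β ω ∧ ∃ d : Dir, SameTrajectory β ω ⟨p.1, p.2, .up⟩ ⟨q.1, q.2, d⟩}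

/-- The set `L(ω)` of all loops of `ω`. -/
def loops (β : ℝ) (ω : Config (Transition G)) : Set (Set (Λ × ℝ)) :=
  loopThrough β ω '' regularPoints β ω

end Loops

/-- `E⁺_{x,y,t}`: the points `(x, 0)` and `(y, t)` belong to the same loop, with identical
vertical directions at these points. -/
def eventPlus (G : SimpleGraph Λ) (β : ℝ) (x y : Λ) (t : ℝ) : Set (Config (Transition G)) :=
  {ω | SameTrajectory β ω ⟨x, 0, .up⟩ ⟨y, t, .up⟩}

/-- `E⁻_{x,y,t}`: the points `(x, 0)` and `(y, t)` belong to the same loop, with opposite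
vertical directions at these points. -/
def eventMinus (G : SimpleGraph Λ) (β : ℝ) (x y : Λ) (t : ℝ) : Set (Config (Transition G)) :=
  {ω | SameTrajectory β ω ⟨x, 0, .up⟩ ⟨y, t, .down⟩}

/-- `E_{x,y,t}`: the points `(x, 0)` and `(y, t)` belong to the same loop. -/
def eventSame (G : SimpleGraph Λ) (β : ℝ) (x y : Λ) (t : ℝ) : Set (Config (Transition G)) :=
  eventPlus G β x y t ∪ eventMinus G β x y t

/-- The weight `θ ^ |L(ω)|`. -/
def loopWeight (G : SimpleGraph Λ) (β θ : ℝ) (ω : Config (Transition G)) : ENNReal :=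
  ENNReal.ofReal (θ ^ (loops β ω).ncard)

/-- The probability measure `(1 / Y) θ ^ |L(ω)| dρ_u(ω)` of the model of random loops. -/
def loopMeasure (G : SimpleGraph Λ) (β u θ : ℝ) : Measure (Config (Transition G)) :=
  (∫⁻ ω, loopWeight G β θ ω ∂(rho G β u))⁻¹ • (rho G β u).withDensity (loopWeight G β θ)

/-! ### Quantum spin systems

The spin is `S = n / 2`. The basis vector `|a⟩` of `ℂ^(2S+1)`, with `a ∈ {-S, …, S}`, has index
`a + S ∈ Fin (n + 1)`, and operators are matrices in the product basis of the tensor product. -/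

/-- The spin `S = n / 2`. -/
def spin (n : ℕ) : ℝ := n / 2

/-- The eigenvalue of `S³` at the basis vector with index `i`. -/
def spinValue (n : ℕ) (i : Fin (n + 1)) : ℝ := (i : ℕ) - spin n

/-- The raising operator `S⁺ |a⟩ = √(S(S+1) - a(a+1)) |a+1⟩`. -/
def spinPlus (n : ℕ) : Matrix (Fin (n + 1)) (Fin (n + 1)) ℂ :=
  Matrix.of fun i j =>
    if (i : ℕ) = j + 1 then
      ((Real.sqrt (spin n * (spin n + 1) - spinValue n j * (spinValue n j + 1)) : ℝ) : ℂ)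
    else 0

/-- The lowering operator. -/
def spinMinus (n : ℕ) : Matrix (Fin (n + 1)) (Fin (n + 1)) ℂ := (spinPlus n).conjTranspose

def spin1 (n : ℕ) : Matrix (Fin (n + 1)) (Fin (n + 1)) ℂ :=
  (1 / 2 : ℂ) • (spinPlus n + spinMinus n)

def spin2 (n : ℕ) : Matrix (Fin (n + 1)) (Fin (n + 1)) ℂ :=
  (1 / (2 * Complex.I)) • (spinPlus n - spinMinus n)

def spin3 (n : ℕ) : Matrix (Fin (n + 1)) (Fin (n + 1)) ℂ :=
  Matrix.diagonal fun i => (spinValue n i : ℂ)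

/-- Operators on the tensor product over `Λ` of copies of `ℂ^(n+1)`. -/
abbrev Op (Λ : Type*) (n : ℕ) : Type _ := Matrix (Λ → Fin (n + 1)) (Λ → Fin (n + 1)) ℂ

open Classical in
/-- `A ⊗ Id`, with `A` acting at the site `x`. -/
def oneSite {n : ℕ} (x : Λ) (A : Matrix (Fin (n + 1)) (Fin (n + 1)) ℂ) : Op Λ n :=
  Matrix.of fun σ τ => if ∀ z, z ≠ x → σ z = τ z then A (σ x) (τ x) else 0

open Classical in
/-- `M ⊗ Id`, with `M` acting at the (distinct) sites `x` and `y`. -/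
def twoSite {n : ℕ} (x y : Λ)
    (M : Matrix (Fin (n + 1) × Fin (n + 1)) (Fin (n + 1) × Fin (n + 1)) ℂ) : Op Λ n :=
  Matrix.of fun σ τ =>
    if ∀ z, z ≠ x → z ≠ y → σ z = τ z then M (σ x, σ y) (τ x, τ y) else 0

/-- The transposition operator `T |a, b⟩ = |b, a⟩`. -/
def transposition (n : ℕ) : Matrix (Fin (n + 1) × Fin (n + 1)) (Fin (n + 1) × Fin (n + 1)) ℂ :=
  Matrix.of fun p q => if p.1 = q.2 ∧ p.2 = q.1 then 1 else 0

/-- The operator `Q` with `⟨a, b| Q |c, d⟩ = δ_{a,b} δ_{c,d}`. -/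
def opQ (n : ℕ) : Matrix (Fin (n + 1) × Fin (n + 1)) (Fin (n + 1) × Fin (n + 1)) ℂ :=
  Matrix.of fun p q => if p.1 = p.2 ∧ q.1 = q.2 then 1 else 0

/-- `u T_{xy} + (1 - u) Q_{xy} - 1`. -/
def pairTerm (n : ℕ) (u : ℝ) (x y : Λ) [Fintype Λ] [DecidableEq Λ] : Op Λ n :=
  (u : ℂ) • twoSite x y (transposition n) + ((1 - u : ℝ) : ℂ) • twoSite x y (opQ n) - 1

lemma pairTerm_comm [Fintype Λ] [DecidableEq Λ] (n : ℕ) (u : ℝ) (x y : Λ) :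
    pairTerm n u x y = pairTerm n u y x := by
  have h : ∀ σ τ : Λ → Fin (n + 1),
      (∀ z, z ≠ x → z ≠ y → σ z = τ z) ↔ (∀ z, z ≠ y → z ≠ x → σ z = τ z) :=
    fun σ τ => forall_congr' fun z => ⟨fun h a b => h b a, fun h a b => h b a⟩
  have hT : twoSite x y (transposition n) = twoSite y x (transposition n) := by
    ext σ τ
    simp only [twoSite, transposition, Matrix.of_apply]
    congr 1
    · exact propext (h σ τ)
    · simp only [and_comm]
  have hQ : twoSite x y (opQ n) = twoSite y x (opQ n) := by
    ext σ τ
    simp only [twoSite, opQ, Matrix.of_apply]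
    congr 1
    · exact propext (h σ τ)
    · simp only [eq_comm]
  rw [pairTerm, pairTerm, hT, hQ]

/-- The Hamiltonian `H^{(u)} = -∑_{{x,y} ∈ edges} (u T_{xy} + (1 - u) Q_{xy} - 1)`. -/
def hamiltonian [Fintype Λ] [DecidableEq Λ] (G : SimpleGraph Λ) [DecidableRel G.Adj]
    (n : ℕ) (u : ℝ) : Op Λ n :=
  -∑ e ∈ G.edgeFinset, Sym2.lift ⟨fun x y => pairTerm n u x y, pairTerm_comm n u⟩ e

/-- The Schwinger function
`⟨A; B⟩(t) = Tr (A exp(-(β - t) H) B exp(-t H)) / Tr exp(-β H)`. -/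
def schwinger [Fintype Λ] [DecidableEq Λ] {n : ℕ} (H : Op Λ n) (β : ℝ) (A B : Op Λ n)
    (t : ℝ) : ℂ :=
  Matrix.trace (A * NormedSpace.exp ((-(β - t) : ℂ) • H) * B * NormedSpace.exp ((-t : ℂ) • H)) /
    Matrix.trace (NormedSpace.exp ((-β : ℂ) • H))

end LoopSpin

end

set_option linter.unusedSectionVars false

noncomputable section

namespace LoopSpin


/-! ### Ordered products with an inserted factor -/

/-! Write H = |E| − K, where K is the sum of the operators u T + (1 − u) Q over the edges. Expanding
both exponentials turns a Schwinger numerator into an integral over ρ_u of traces of time-ordered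
products of T's and Q's, with A inserted at time 0 and B at time t (`integral_rho`). The scalar |E|
is matched by the normalization of the Poisson process, and the binomial choice of the times after t
produces the Cauchy product of the two series.

For a fixed sequence of transitions the problem is combinatorial. In the basis |a⟩ the trace is a
sum over labelings of space-time slices that are constant along trajectories
(`trace_eq_sum_labelings`), that is, over one free label per loop (`labelingEquiv`). Without
insertions this gives θ^|L|. With two copies of S³, labels of distinct loops are independent with
mean zero and contribute nothing, while a common loop contributes (∑ a²) θ^(|L| − 1).

S¹ and S² are not diagonal. Up to a scalar they are S⁺ + η S⁻ with η = ±1, a combination of matrices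
supported in the planes of consecutive basis vectors. A sign change of one basis vector kills the
products of two different planes (`insertTrace_planeMat_eq_zero`). For a repeated plane, a matrix V
diagonalizes both insertions and is applied at every site: V ⊗ V commutes with T, and if V Vᵀ is the
permutation matrix of an involution ι, then V ⊗ V turns Q into a double bar whose endpoints carry
labels exchanged by ι (`tensorPow_mul_bar`). For η = 1 one has ι = id. For η = −1, ι swaps the two
vectors of the plane; labels then change by ι when the direction reverses, and the inserted diagonal
matrix is odd under ι, whence the minus sign of E⁻ (`sum_labelings_mul`).

The same change of basis without insertions shows that no trajectory returns to a point in the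
reverse direction (`not_conn_reverse`), so E⁺ and E⁻ are almost surely disjoint. Continuous
trajectories agree with the discrete ones at regular points (`sameTrajectory_iff`, `ncard_loops`),
for configurations with distinct transition times in (0, β), which are almost all. -/

/-- The product of a list with the factor `b` inserted at position `l`. -/
def insertProd {R : Type*} [Monoid R] (b : R) : ℕ → List R → R
  | 0, L => b * L.prod
  -- A position past the end puts `b` last, so that linearity and intertwining need no bound on the
  -- position; only `sum_insertProd_ofFn` does.
  | _ + 1, [] => b
  | l + 1, a :: L => a * insertProd b l L

lemma insertProd_add {R : Type*} [Semiring R] (b c : R) (l : ℕ) (L : List R) :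
    insertProd (b + c) l L = insertProd b l L + insertProd c l L := by
  induction L generalizing l with
  | nil => cases l <;> simp [insertProd]
  | cons a L ih => cases l <;> simp [insertProd, ih, add_mul, mul_add]

lemma insertProd_smul {R : Type*} [Semiring R] [Algebra ℂ R] (z : ℂ) (b : R) (l : ℕ)
    (L : List R) : insertProd (z • b) l L = z • insertProd b l L := by
  induction L generalizing l with
  | nil => cases l <;> simp [insertProd]
  | cons a L ih => cases l <;> simp [insertProd, ih]

lemma list_prod_intertwine {R : Type*} [Monoid R] {w : R} {k : ℕ} {f g : Fin k → R}
    (h : ∀ i, w * f i = g i * w) :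
    w * (List.ofFn f).prod = (List.ofFn g).prod * w := by
  induction k with
  | zero => simp
  | succ k ih =>
    rw [List.ofFn_succ, List.ofFn_succ, List.prod_cons, List.prod_cons, ← mul_assoc, h,
      mul_assoc, ih fun i => h i.succ, mul_assoc]

lemma insertProd_intertwine {R : Type*} [Monoid R] {w b c : R} (hb : w * b = c * w) {k : ℕ}
    {f g : Fin k → R} (h : ∀ i, w * f i = g i * w) (l : ℕ) :
    w * insertProd b l (List.ofFn f) = insertProd c l (List.ofFn g) * w := by
  induction k generalizing l with
  | zero => cases l <;> simp [insertProd, hb]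
  | succ k ih =>
    cases l with
    | zero =>
      simp only [insertProd]
      rw [← mul_assoc, hb, mul_assoc, list_prod_intertwine h, mul_assoc]
    | succ l =>
      rw [List.ofFn_succ, List.ofFn_succ]
      simp only [insertProd]
      rw [← mul_assoc, h, mul_assoc, ih fun i => h i.succ, mul_assoc]

lemma list_prod_ofFn_smul {R : Type*} [Semiring R] [Algebra ℂ R] {k : ℕ} (z : Fin k → ℂ)
    (f : Fin k → R) :
    (List.ofFn fun i => z i • f i).prod = (∏ i, z i) • (List.ofFn f).prod := by
  induction k with
  | zero => simp
  | succ k ih =>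
    rw [List.ofFn_succ, List.prod_cons, ih (fun i => z i.succ) fun i => f i.succ,
      List.ofFn_succ, List.prod_cons, Fin.prod_univ_succ, smul_mul_smul_comm]

lemma insertProd_ofFn_smul {R : Type*} [Semiring R] [Algebra ℂ R] (b : R) {k : ℕ}
    (z : Fin k → ℂ) (f : Fin k → R) (l : ℕ) :
    insertProd b l (List.ofFn fun i => z i • f i) =
      (∏ i, z i) • insertProd b l (List.ofFn f) := by
  induction k generalizing l with
  | zero => simp
  | succ k ih =>
    cases l with
    | zero => simp only [insertProd, list_prod_ofFn_smul, mul_smul_comm]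
    | succ l =>
      rw [List.ofFn_succ, List.ofFn_succ]
      simp only [insertProd]
      rw [ih (fun i => z i.succ) fun i => f i.succ, Fin.prod_univ_succ, smul_mul_smul_comm]

lemma sum_list_prod_ofFn {R ι : Type*} [Semiring R] [Fintype ι] (φ : ι → R) (k : ℕ) :
    ∑ f : Fin k → ι, (List.ofFn fun i => φ (f i)).prod = (∑ a, φ a) ^ k := by
  induction k with
  | zero => simp
  | succ k ih =>
    rw [← (Fin.consEquiv fun _ : Fin (k + 1) => ι).sum_comp, Fintype.sum_prod_type, pow_succ',
      ← ih, Finset.sum_mul_sum]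
    simp [Fin.consEquiv]

lemma sum_insertProd_ofFn {R ι : Type*} [Semiring R] [Fintype ι] (b : R) (φ : ι → R)
    (k l : ℕ) (hl : l ≤ k) :
    ∑ f : Fin k → ι, insertProd b l (List.ofFn fun i => φ (f i)) =
      (∑ a, φ a) ^ l * b * (∑ a, φ a) ^ (k - l) := by
  induction k generalizing l with
  | zero =>
    obtain rfl : l = 0 := by omega
    simp [insertProd]
  | succ k ih =>
    cases l with
    | zero =>
      simp only [insertProd]
      rw [← Finset.mul_sum, sum_list_prod_ofFn]
      simp
    | succ l =>
      rw [← (Fin.consEquiv fun _ : Fin (k + 1) => ι).sum_comp, Fintype.sum_prod_type]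
      simp only [Fin.consEquiv, Equiv.coe_fn_mk, List.ofFn_succ, insertProd, Fin.cons_zero,
        Fin.cons_succ]
      rw [← Finset.sum_mul_sum, ih l (by omega), pow_succ', Nat.succ_sub_succ]
      simp only [mul_assoc]

/-- Expansion of the entries of an ordered product of matrices as a sum over paths. -/
lemma list_prod_apply_eq_sum_paths {S : Type*} [Fintype S] [DecidableEq S] {k : ℕ}
    (N : Fin k → Matrix S S ℂ) (a b : S) :
    (List.ofFn N).prod a b = ∑ σ : Fin (k + 1) → S,
      if σ 0 = a ∧ σ (Fin.last k) = b then ∏ i, N i (σ i.castSucc) (σ i.succ) else 0 := by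
  induction k generalizing a with
  | zero =>
    rw [← (Equiv.funUnique (Fin 1) S).symm.sum_comp]
    simp only [List.ofFn_zero, List.prod_nil, Matrix.one_apply]
    simp [Equiv.funUnique, Finset.filter_and, Finset.filter_eq']
    split_ifs with h <;> simp_all
  | succ k ih =>
    rw [← (Fin.consEquiv fun _ : Fin (k + 2) => S).sum_comp, Fintype.sum_prod_type,
      List.ofFn_succ, List.prod_cons, Matrix.mul_apply]
    simp only [ih, Fin.consEquiv, Equiv.coe_fn_mk, Fin.cons_zero, Fin.prod_univ_succ,
      Finset.mul_sum, Fin.castSucc_zero, Fin.cons_succ, ← Fin.succ_last, ← Fin.succ_castSucc]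
    rw [Finset.sum_comm, Finset.sum_comm (γ := S)]
    refine Finset.sum_congr rfl fun σ _ => ?_
    -- The intermediate state of the matrix product is the first vertex of the tail, and the new
    -- first vertex is `a`.
    rw [Finset.sum_eq_single (σ 0), Finset.sum_eq_single a]
    · simp
    · intro c _ hc
      simp [hc]
    · simp
    · intro c _ hc
      simp [Ne.symm hc]
    · simp

/-- A diagonal factor does not add a vertex to the path: it only weights the state at the slice
where it is inserted. -/
lemma insertProd_apply_eq_sum_paths {S : Type*} [Fintype S] [DecidableEq S] {k : ℕ}
    (N : Fin k → Matrix S S ℂ) (d : S → ℂ) (l : Fin (k + 1)) (a b : S) :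
    insertProd (Matrix.diagonal d) l (List.ofFn N) a b = ∑ σ : Fin (k + 1) → S,
      if σ 0 = a ∧ σ (Fin.last k) = b then d (σ l) * ∏ i, N i (σ i.castSucc) (σ i.succ)
      else 0 := by
  induction k generalizing a with
  | zero =>
    obtain rfl : l = 0 := Fin.ext (by omega)
    simp only [insertProd, Matrix.diagonal_mul, list_prod_apply_eq_sum_paths,
      Finset.mul_sum, mul_ite, mul_zero]
    refine Finset.sum_congr rfl fun σ _ => ?_
    split_ifs with h
    · rw [h.1]
    · rfl
  | succ k ih =>
    refine Fin.cases ?_ (fun l => ?_) l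
    · simp only [insertProd, Fin.val_zero, Matrix.diagonal_mul, list_prod_apply_eq_sum_paths,
        Finset.mul_sum, mul_ite, mul_zero]
      refine Finset.sum_congr rfl fun σ _ => ?_
      split_ifs with h
      · rw [h.1]
      · rfl
    · rw [← (Fin.consEquiv fun _ : Fin (k + 2) => S).sum_comp, Fintype.sum_prod_type,
        List.ofFn_succ, Fin.val_succ, insertProd, Matrix.mul_apply]
      simp only [ih, Fin.consEquiv, Equiv.coe_fn_mk, Fin.cons_zero, Fin.prod_univ_succ,
        Finset.mul_sum, Fin.castSucc_zero, Fin.cons_succ, ← Fin.succ_last, ← Fin.succ_castSucc]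
      rw [Finset.sum_comm, Finset.sum_comm (γ := S)]
      refine Finset.sum_congr rfl fun σ _ => ?_
      rw [Finset.sum_eq_single (σ 0), Finset.sum_eq_single a]
      · simp only [true_and, mul_ite, mul_zero]
        split_ifs <;> ring
      · intro c _ hc
        simp [hc]
      · simp
      · intro c _ hc
        simp [Ne.symm hc]
      · simp

/-- The trace of an ordered product with two diagonal factors, as a sum over closed paths. -/
lemma trace_diagonal_insertProd {S : Type*} [Fintype S] [DecidableEq S] {k : ℕ}
    (N : Fin k → Matrix S S ℂ) (d d' : S → ℂ) (l : Fin (k + 1)) :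
    (Matrix.diagonal d * insertProd (Matrix.diagonal d') l (List.ofFn N)).trace =
      ∑ σ : Fin (k + 1) → S, if σ (Fin.last k) = σ 0 then
        d (σ 0) * d' (σ l) * ∏ i, N i (σ i.castSucc) (σ i.succ) else 0 := by
  simp only [Matrix.trace, Matrix.diag_apply, Matrix.diagonal_mul,
    insertProd_apply_eq_sum_paths, Finset.mul_sum]
  rw [Finset.sum_comm]
  refine Finset.sum_congr rfl fun σ _ => ?_
  rw [Finset.sum_eq_single (σ 0)]
  · simp only [true_and, mul_ite, mul_zero, mul_assoc]
  · intro c _ hc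
    simp [Ne.symm hc]
  · simp


/-! ### Transition operators and their transformation under product operators -/

section Operators

variable {Λ : Type*} {n : ℕ}

/-- The spin configurations just after and just before a transition on the edge `e` are compatible:
across a cross the spins are exchanged, at a double bar the spins of the two endpoints are related
by the involution `ι`. -/
def Compat (ι : Fin (n + 1) → Fin (n + 1)) (e : Sym2 Λ) (κ : Kind) (σ τ : Λ → Fin (n + 1)) :
    Prop :=
  (∀ z, z ∉ e → σ z = τ z) ∧
    match κ with
    | .cross => ∀ x y, e = s(x, y) → σ x = τ y
    | .bar => ∀ x y, e = s(x, y) → σ y = ι (σ x) ∧ τ y = ι (τ x)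

open Classical in
/-- The operator of a transition. -/
def transMat (ι : Fin (n + 1) → Fin (n + 1)) (e : Sym2 Λ) (κ : Kind) : Op Λ n :=
  Matrix.of fun σ τ => if Compat ι e κ σ τ then 1 else 0

variable [Fintype Λ]

/-- The operator `V ⊗ ⋯ ⊗ V`. -/
def tensorPow (V : Matrix (Fin (n + 1)) (Fin (n + 1)) ℂ) : Op Λ n :=
  Matrix.of fun σ τ => ∏ z, V (σ z) (τ z)

variable [DecidableEq Λ]

lemma tensorPow_mul (V W : Matrix (Fin (n + 1)) (Fin (n + 1)) ℂ) :
    (tensorPow V : Op Λ n) * tensorPow W = tensorPow (V * W) := by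
  ext σ τ
  simp only [tensorPow, Matrix.mul_apply, Matrix.of_apply, Finset.prod_univ_sum,
    ← Finset.prod_mul_distrib, Fintype.piFinset_univ]

lemma tensorPow_one : (tensorPow 1 : Op Λ n) = 1 := by
  ext σ τ
  simp only [tensorPow, Matrix.of_apply, Matrix.one_apply, Finset.prod_ite_zero]
  simp [funext_iff]

/-- Only the site `x` matters: the intermediate configurations that contribute differ from the outer
one at `x` alone, the other sites give a common factor, and at `x` the identity is `h`. -/
lemma tensorPow_mul_oneSite {V A A' : Matrix (Fin (n + 1)) (Fin (n + 1)) ℂ}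
    (h : V * A = A' * V) (x : Λ) :
    tensorPow V * oneSite x A = oneSite x A' * tensorPow V := by
  ext σ τ
  simp only [tensorPow, oneSite, Matrix.mul_apply, Matrix.of_apply]
  have key : ∀ a : Fin (n + 1), ∀ τ : Λ → Fin (n + 1),
      ∏ z, V (σ z) (Function.update τ x a z) =
        V (σ x) a * ∏ z ∈ Finset.univ.erase x, V (σ z) (τ z) := fun a τ => by
    rw [← Finset.mul_prod_erase _ _ (Finset.mem_univ x), Function.update_self]
    congr 1
    refine Finset.prod_congr rfl fun z hz => ?_
    rw [Function.update_of_ne (Finset.ne_of_mem_erase hz)]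
  have key' : ∀ a : Fin (n + 1),
      ∏ z, V (Function.update σ x a z) (τ z) =
        V a (τ x) * ∏ z ∈ Finset.univ.erase x, V (σ z) (τ z) := fun a => by
    rw [← Finset.mul_prod_erase _ _ (Finset.mem_univ x), Function.update_self]
    congr 1
    refine Finset.prod_congr rfl fun z hz => ?_
    rw [Function.update_of_ne (Finset.ne_of_mem_erase hz)]
  -- Both matrix products collapse to sums over the value at `x`, embedded among configurations by
  -- `Function.update`.
  have e1 := Fintype.sum_of_injective (fun a => Function.update τ x a)
    (Function.update_injective τ x)
    (fun a => (V (σ x) a * A a (τ x)) * ∏ z ∈ Finset.univ.erase x, V (σ z) (τ z))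
    (fun ρ => (∏ z, V (σ z) (ρ z)) * if ∀ z, z ≠ x → ρ z = τ z then A (ρ x) (τ x) else 0)
    (fun ρ hρ => by
      rw [if_neg, mul_zero]
      exact fun hc => hρ ⟨ρ x, by
        ext z
        by_cases hz : z = x
        · subst hz; simp
        · simp [Function.update_of_ne hz, hc z hz]⟩)
    (fun a => by
      rw [if_pos fun z hz => Function.update_of_ne hz _ _, key, Function.update_self]
      ring)
  have e2 := Fintype.sum_of_injective (fun a => Function.update σ x a)
    (Function.update_injective σ x)
    (fun a => (A' (σ x) a * V a (τ x)) * ∏ z ∈ Finset.univ.erase x, V (σ z) (τ z))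
    (fun ρ => (if ∀ z, z ≠ x → σ z = ρ z then A' (σ x) (ρ x) else 0) * ∏ z, V (ρ z) (τ z))
    (fun ρ hρ => by
      rw [if_neg, zero_mul]
      exact fun hc => hρ ⟨ρ x, by
        ext z
        by_cases hz : z = x
        · subst hz; simp
        · simp [Function.update_of_ne hz, hc z hz]⟩)
    (fun a => by
      rw [if_pos fun z hz => (Function.update_of_ne hz _ _).symm, key', Function.update_self]
      ring)
  have e3 : ∑ a, (V (σ x) a * A a (τ x)) * ∏ z ∈ Finset.univ.erase x, V (σ z) (τ z) =
      ∑ a, (A' (σ x) a * V a (τ x)) * ∏ z ∈ Finset.univ.erase x, V (σ z) (τ z) := by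
    rw [← Finset.sum_mul, ← Finset.sum_mul, ← Matrix.mul_apply, ← Matrix.mul_apply, h]
  convert e1.symm.trans (e3.trans e2)

lemma compat_cross_iff (ι : Fin (n + 1) → Fin (n + 1)) (x y : Λ) (σ τ : Λ → Fin (n + 1)) :
    Compat ι s(x, y) .cross σ τ ↔ σ = τ ∘ Equiv.swap x y := by
  simp only [Compat, Sym2.mem_iff, Sym2.eq_iff, not_or, funext_iff, Function.comp_apply]
  constructor
  · rintro ⟨h1, h2⟩ z
    by_cases hx : z = x
    · subst hx; rw [Equiv.swap_apply_left]; exact h2 _ _ (Or.inl ⟨rfl, rfl⟩)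
    by_cases hy : z = y
    · subst hy; rw [Equiv.swap_apply_right]; exact h2 _ _ (Or.inr ⟨rfl, rfl⟩)
    rw [Equiv.swap_apply_of_ne_of_ne hx hy]
    exact h1 z ⟨hx, hy⟩
  · intro h
    refine ⟨fun z hz => by rw [h, Equiv.swap_apply_of_ne_of_ne hz.1 hz.2], ?_⟩
    rintro a b (⟨rfl, rfl⟩ | ⟨rfl, rfl⟩)
    · rw [h, Equiv.swap_apply_left]
    · rw [h, Equiv.swap_apply_right]

/-- Involutivity makes the condition for one ordering of the endpoints imply the condition for the
other. -/
lemma compat_bar_iff {ι : Fin (n + 1) → Fin (n + 1)} (hι : Function.Involutive ι) (x y : Λ)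
    (σ τ : Λ → Fin (n + 1)) :
    Compat ι s(x, y) .bar σ τ ↔
      (∀ z, z ≠ x → z ≠ y → σ z = τ z) ∧ σ y = ι (σ x) ∧ τ y = ι (τ x) := by
  simp only [Compat, Sym2.mem_iff, Sym2.eq_iff, not_or, and_imp]
  refine and_congr_right fun _ => ⟨fun h => h x y (Or.inl ⟨rfl, rfl⟩), ?_⟩
  rintro ⟨h1, h2⟩ a b (⟨rfl, rfl⟩ | ⟨rfl, rfl⟩)
  · exact ⟨h1, h2⟩
  · rw [h1, h2, hι, hι]
    exact ⟨rfl, rfl⟩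

/-- The permutation matrix of an involution. -/
def involMat (ι : Fin (n + 1) → Fin (n + 1)) : Matrix (Fin (n + 1)) (Fin (n + 1)) ℂ :=
  Matrix.of fun a b => if b = ι a then 1 else 0

lemma involMat_mul_self {ι : Fin (n + 1) → Fin (n + 1)} (hι : Function.Involutive ι) :
    involMat ι * involMat ι = 1 := by
  ext a b
  simp only [involMat, Matrix.mul_apply, Matrix.of_apply, mul_ite, mul_one, mul_zero,
    Matrix.one_apply]
  rw [Finset.sum_eq_single (ι a)]
  · simp [hι a, eq_comm]
  · intro c _ hc
    simp [hc]
  · simp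

/-- A cross permutes the sites, and a product over all sites is invariant under permutation. The
involution plays no role at a cross, hence the unrelated `ι` and `ι'`. -/
lemma tensorPow_mul_cross (V : Matrix (Fin (n + 1)) (Fin (n + 1)) ℂ)
    (ι ι' : Fin (n + 1) → Fin (n + 1)) (x y : Λ) :
    tensorPow V * transMat ι s(x, y) .cross = transMat ι' s(x, y) .cross * tensorPow V := by
  ext σ τ
  simp only [tensorPow, transMat, Matrix.mul_apply, Matrix.of_apply, compat_cross_iff]
  rw [Finset.sum_eq_single (τ ∘ Equiv.swap x y), Finset.sum_eq_single (σ ∘ Equiv.swap x y)]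
  · rw [if_pos rfl, if_pos (by ext; simp), mul_one, one_mul]
    rw [← Equiv.prod_comp (Equiv.swap x y)]
    simp
  · intro ρ _ hρ
    rw [if_neg, zero_mul]
    rintro rfl
    exact hρ (by ext; simp)
  · simp
  · intro ρ _ hρ
    rw [if_neg hρ, mul_zero]
  · simp

/-- Q is the rank-one operator of the vector ∑ |a, a⟩. The image of this vector under V ⊗ V has the
entries of V Vᵀ as coordinates, so it is ∑ |a, ι a⟩; on the other side, Vᵀ P V = 1 with P the matrix
of ι says that V ⊗ V carries the row vector of the ι-bar back to that of Q. -/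
lemma tensorPow_mul_bar {V : Matrix (Fin (n + 1)) (Fin (n + 1)) ℂ}
    {ι : Fin (n + 1) → Fin (n + 1)} (hι : Function.Involutive ι)
    (hV : V * V.transpose = involMat ι) {x y : Λ} (hxy : x ≠ y) :
    tensorPow V * transMat id s(x, y) .bar = transMat ι s(x, y) .bar * tensorPow V := by
  have hid : Function.Involutive (id : Fin (n + 1) → Fin (n + 1)) := fun _ => rfl
  -- V (Vᵀ P) = P² = 1, and a right inverse of a square matrix is a left inverse.
  have hV' : V.transpose * involMat ι * V = 1 := by
    rw [mul_eq_one_comm, ← mul_assoc, hV, involMat_mul_self hι]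
  have hVe : ∀ a b, ∑ c, V a c * V b c = if b = ι a then 1 else 0 := fun a b => by
    simpa [Matrix.mul_apply, involMat] using congrFun (congrFun hV a) b
  have hVe' : ∀ a b, ∑ c, V c a * V (ι c) b = if b = a then 1 else 0 := fun a b => by
    have := congrFun (congrFun hV' a) b
    rw [mul_assoc, Matrix.mul_apply] at this
    simpa [Matrix.mul_apply, involMat, Matrix.one_apply, eq_comm] using this
  ext σ τ
  simp only [tensorPow, transMat, Matrix.mul_apply, Matrix.of_apply,
    compat_bar_iff hι, compat_bar_iff hid]
  set R : ℂ := ∏ z ∈ (Finset.univ.erase x).erase y, V (σ z) (τ z) with hR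
  have hy : y ∈ Finset.univ.erase x := Finset.mem_erase.2 ⟨hxy.symm, Finset.mem_univ _⟩
  have key : ∀ a b : Fin (n + 1),
      ∏ z, V (σ z) (Function.update (Function.update τ x a) y b z) =
        V (σ x) a * V (σ y) b * R := fun a b => by
    rw [← Finset.mul_prod_erase _ _ (Finset.mem_univ x), ← Finset.mul_prod_erase _ _ hy,
      Function.update_self, Function.update_of_ne hxy, Function.update_self, mul_assoc, hR]
    congr 2
    refine Finset.prod_congr rfl fun z hz => ?_
    rw [Finset.mem_erase, Finset.mem_erase] at hz
    rw [Function.update_of_ne hz.1, Function.update_of_ne hz.2.1]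
  have key' : ∀ a b : Fin (n + 1),
      ∏ z, V (Function.update (Function.update σ x a) y b z) (τ z) =
        V a (τ x) * V b (τ y) * R := fun a b => by
    rw [← Finset.mul_prod_erase _ _ (Finset.mem_univ x), ← Finset.mul_prod_erase _ _ hy,
      Function.update_self, Function.update_of_ne hxy, Function.update_self, mul_assoc, hR]
    congr 2
    refine Finset.prod_congr rfl fun z hz => ?_
    rw [Finset.mem_erase, Finset.mem_erase] at hz
    rw [Function.update_of_ne hz.1, Function.update_of_ne hz.2.1]
  have inj : ∀ (j : Fin (n + 1) → Fin (n + 1)) (τ : Λ → Fin (n + 1)), Function.Injective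
      fun a => Function.update (Function.update τ x a) y (j a) := fun j τ a b hab => by
    have := congrFun hab x
    simpa [Function.update_of_ne hxy] using this
  have upd : ∀ (τ ρ : Λ → Fin (n + 1)) (b : Fin (n + 1)), (∀ z, z ≠ x → z ≠ y → ρ z = τ z) →
      ρ y = b → Function.update (Function.update τ x (ρ x)) y b = ρ := fun τ ρ b h hb => by
    ext z
    by_cases hzy : z = y
    · subst hzy; simp [hb]
    rw [Function.update_of_ne hzy]
    by_cases hzx : z = x
    · subst hzx; simp
    rw [Function.update_of_ne hzx, h z hzx hzy]
  have e1 := Fintype.sum_of_injective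
    (fun a => Function.update (Function.update τ x a) y (id a)) (inj id τ)
    (fun a => (V (σ x) a * V (σ y) a) * (R * if τ y = τ x then 1 else 0))
    (fun ρ => (∏ z, V (σ z) (ρ z)) *
      if (∀ z, z ≠ x → z ≠ y → ρ z = τ z) ∧ ρ y = id (ρ x) ∧ τ y = id (τ x) then 1 else 0)
    (fun ρ hρ => by
      rw [if_neg, mul_zero]
      exact fun hc => hρ ⟨ρ x, upd _ _ _ hc.1 hc.2.1⟩)
    (fun a => by
      rw [key]
      have h1 : ∀ z, z ≠ x → z ≠ y →
          Function.update (Function.update τ x a) y (id a) z = τ z := fun z hz hz' => by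
        rw [Function.update_of_ne hz', Function.update_of_ne hz]
      have h2 : (∀ z, z ≠ x → z ≠ y →
          Function.update (Function.update τ x a) y (id a) z = τ z) = True := eq_true h1
      simp only [h2, Function.update_self, Function.update_of_ne hxy]
      simp [mul_assoc])
  have e2 := Fintype.sum_of_injective
    (fun a => Function.update (Function.update σ x a) y (ι a)) (inj ι σ)
    (fun a => (V a (τ x) * V (ι a) (τ y)) * (R * if σ y = ι (σ x) then 1 else 0))
    (fun ρ => (if (∀ z, z ≠ x → z ≠ y → σ z = ρ z) ∧ σ y = ι (σ x) ∧ ρ y = ι (ρ x)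
      then 1 else 0) * ∏ z, V (ρ z) (τ z))
    (fun ρ hρ => by
      rw [if_neg, zero_mul]
      exact fun hc => hρ ⟨ρ x, upd _ _ _ (fun z hz hz' => (hc.1 z hz hz').symm) hc.2.2⟩)
    (fun a => by
      rw [key']
      have h1 : ∀ z, z ≠ x → z ≠ y →
          σ z = Function.update (Function.update σ x a) y (ι a) z := fun z hz hz' => by
        rw [Function.update_of_ne hz', Function.update_of_ne hz]
      have h2 : (∀ z, z ≠ x → z ≠ y →
          σ z = Function.update (Function.update σ x a) y (ι a) z) = True := eq_true h1
      simp only [h2, Function.update_self, Function.update_of_ne hxy]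
      simp [mul_comm])
  have e3 : ∑ a, (V (σ x) a * V (σ y) a) * (R * if τ y = τ x then 1 else 0) =
      ∑ a, (V a (τ x) * V (ι a) (τ y)) * (R * if σ y = ι (σ x) then 1 else 0) := by
    rw [← Finset.sum_mul, ← Finset.sum_mul, hVe, hVe']
    ring
  convert e1.symm.trans (e3.trans e2)

lemma tensorPow_mul_transMat {V : Matrix (Fin (n + 1)) (Fin (n + 1)) ℂ}
    {ι : Fin (n + 1) → Fin (n + 1)} (hι : Function.Involutive ι)
    (hV : V * V.transpose = involMat ι) {e : Sym2 Λ} (he : ¬ e.IsDiag) (κ : Kind) :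
    tensorPow V * transMat id e κ = transMat ι e κ * tensorPow V := by
  induction e using Sym2.ind with
  | _ x y =>
    cases κ with
    | cross => exact tensorPow_mul_cross V _ _ x y
    | bar => exact tensorPow_mul_bar hι hV (by simpa using he)

/-- Traces of ordered products with two one-site insertions, after a change of basis. -/
lemma trace_oneSite_insertProd_conj {V A A' B B' : Matrix (Fin (n + 1)) (Fin (n + 1)) ℂ}
    {ι : Fin (n + 1) → Fin (n + 1)} (hι : Function.Involutive ι)
    (hV : V * V.transpose = involMat ι) (hA : V * A = A' * V) (hB : V * B = B' * V)
    {k : ℕ} {e : Fin k → Sym2 Λ} (he : ∀ i, ¬ (e i).IsDiag) (κ : Fin k → Kind) (l : ℕ)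
    (x y : Λ) :
    (oneSite x A * insertProd (oneSite y B) l
        (List.ofFn fun i => transMat id (e i) (κ i))).trace =
      (oneSite x A' * insertProd (oneSite y B') l
        (List.ofFn fun i => transMat ι (e i) (κ i))).trace := by
  have hV1 : (V.transpose * involMat ι) * V = 1 := by
    rw [mul_eq_one_comm, ← mul_assoc, hV, involMat_mul_self hι]
  set W : Op Λ n := tensorPow V
  set W' : Op Λ n := tensorPow (V.transpose * involMat ι)
  have hW : W' * W = 1 := by rw [tensorPow_mul, hV1, tensorPow_one]
  -- `W` is moved through the product from left to right, changing each factor; cyclicity of the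
  -- trace then cancels it against `W'`.
  have h1 : W * (oneSite x A * insertProd (oneSite y B) l
        (List.ofFn fun i => transMat id (e i) (κ i))) = (oneSite x A' *
        insertProd (oneSite y B') l (List.ofFn fun i => transMat ι (e i) (κ i))) * W := by
    rw [← mul_assoc, tensorPow_mul_oneSite hA, mul_assoc,
      insertProd_intertwine (tensorPow_mul_oneSite hB y)
        (fun i => tensorPow_mul_transMat hι hV (he i) (κ i)), mul_assoc]
  rw [← one_mul (oneSite x A * _), ← hW, mul_assoc, h1, Matrix.trace_mul_comm, mul_assoc,
    mul_eq_one_comm.1 hW, mul_one]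

lemma oneSite_one (x : Λ) : (oneSite x 1 : Op Λ n) = 1 := by
  ext σ τ
  simp only [oneSite, Matrix.of_apply, Matrix.one_apply]
  by_cases h : σ = τ
  · simp [h]
  · rw [if_neg h]
    split_ifs with h1 h2
    · exact absurd (funext fun z => by
        by_cases hz : z = x
        · subst hz; exact h2
        · exact h1 z hz) h
    · rfl
    · rfl

lemma oneSite_diagonal (x : Λ) (d : Fin (n + 1) → ℂ) :
    (oneSite x (Matrix.diagonal d) : Op Λ n) = Matrix.diagonal fun σ => d (σ x) := by
  ext σ τ
  simp only [oneSite, Matrix.of_apply, Matrix.diagonal_apply]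
  by_cases h : σ = τ
  · simp [h]
  · rw [if_neg h]
    split_ifs with h1 h2
    · exact absurd (funext fun z => by
        by_cases hz : z = x
        · subst hz; exact h2
        · exact h1 z hz) h
    · rfl
    · rfl

lemma oneSite_add (x : Λ) (A B : Matrix (Fin (n + 1)) (Fin (n + 1)) ℂ) :
    (oneSite x (A + B) : Op Λ n) = oneSite x A + oneSite x B := by
  ext σ τ
  simp only [oneSite, Matrix.of_apply, Matrix.add_apply]
  split_ifs <;> simp

lemma oneSite_smul (x : Λ) (c : ℂ) (A : Matrix (Fin (n + 1)) (Fin (n + 1)) ℂ) :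
    (oneSite x (c • A) : Op Λ n) = c • oneSite x A := by
  ext σ τ
  simp only [oneSite, Matrix.of_apply, Matrix.smul_apply]
  split_ifs <;> simp

end Operators


/-! ### The discrete loop structure of a sequence of transitions -/

/-- The product of directions, with `up` as the unit. -/
def Dir.mul : Dir → Dir → Dir
  | .up, d => d
  | .down, .up => .down
  | .down, .down => .up

lemma Dir.mul_mul_self (d d' : Dir) : Dir.mul (Dir.mul d d') d' = d := by
  cases d <;> cases d' <;> rfl

lemma Dir.mul_up (d : Dir) : Dir.mul d .up = d := by
  cases d <;> rfl

section Discrete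

variable {Λ : Type*} {k : ℕ}

/-- The elementary adjacencies of oriented time slices. The transitions are listed backwards in
time; the transition `i` separates the later slice `i.castSucc` from the earlier slice `i.succ`. -/
inductive Step (e : Fin k → Sym2 Λ) (κ : Fin k → Kind) :
    (Λ × Fin (k + 1)) × Dir → (Λ × Fin (k + 1)) × Dir → Prop
  | skip {z : Λ} {i : Fin k} (d : Dir) (h : z ∉ e i) :
      Step e κ ((z, i.castSucc), d) ((z, i.succ), d)
  | cross {x y : Λ} {i : Fin k} (d : Dir) (h : e i = s(x, y)) (hκ : κ i = .cross) :
      Step e κ ((x, i.succ), d) ((y, i.castSucc), d)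
  | barBelow {x y : Λ} {i : Fin k} (h : e i = s(x, y)) (hκ : κ i = .bar) :
      Step e κ ((x, i.succ), .up) ((y, i.succ), .down)
  | barAbove {x y : Λ} {i : Fin k} (h : e i = s(x, y)) (hκ : κ i = .bar) :
      Step e κ ((x, i.castSucc), .down) ((y, i.castSucc), .up)
  | wrap (z : Λ) (d : Dir) : Step e κ ((z, Fin.last k), d) ((z, 0), d)

/-- Two oriented time slices lie on the same discrete trajectory. -/
def Conn (e : Fin k → Sym2 Λ) (κ : Fin k → Kind) (a b : (Λ × Fin (k + 1)) × Dir) : Prop :=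
  Relation.EqvGen (Step e κ) a b

variable {e : Fin k → Sym2 Λ} {κ : Fin k → Kind}

lemma Step.conn {a b : (Λ × Fin (k + 1)) × Dir} (h : Step e κ a b) : Conn e κ a b :=
  .rel _ _ h

lemma Conn.refl (a : (Λ × Fin (k + 1)) × Dir) : Conn e κ a a :=
  Relation.EqvGen.refl a

lemma Conn.symm {a b : (Λ × Fin (k + 1)) × Dir} (h : Conn e κ a b) : Conn e κ b a :=
  Relation.EqvGen.symm _ _ h

lemma Conn.trans {a b c : (Λ × Fin (k + 1)) × Dir} (h : Conn e κ a b) (h' : Conn e κ b c) :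
    Conn e κ a c :=
  Relation.EqvGen.trans _ _ _ h h'

/-- Reversing both directions preserves vertical moves and crosses, and turns a bar adjacency into
the inverse of the same kind of adjacency with its endpoints exchanged. -/
lemma Conn.flip {a b : (Λ × Fin (k + 1)) × Dir} (h : Conn e κ a b) (d : Dir) :
    Conn e κ (a.1, d.mul a.2) (b.1, d.mul b.2) := by
  cases d with
  | up => exact h
  | down =>
    induction h with
    | rel a b h =>
      cases h with
      | skip d h => exact (Step.skip _ h).conn
      | cross d h hκ => exact (Step.cross _ h hκ).conn
      | barBelow h hκ => exact (Step.barBelow (h.trans Sym2.eq_swap) hκ).conn.symm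
      | barAbove h hκ => exact (Step.barAbove (h.trans Sym2.eq_swap) hκ).conn.symm
      | wrap z d => exact (Step.wrap _ _).conn
    | refl a => exact .refl _
    | symm a b _ ih => exact ih.symm
    | trans a b c _ _ ih ih' => exact ih.trans ih'

lemma conn_of_sites {z : Λ} {a b : Fin (k + 1)} (hab : a ≤ b) (d : Dir)
    (h : ∀ i : Fin k, (a : ℕ) ≤ i → (i : ℕ) < b → z ∉ e i) :
    Conn e κ ((z, a), d) ((z, b), d) := by
  obtain ⟨a, ha⟩ := a
  obtain ⟨b, hb⟩ := b
  simp only [Fin.mk_le_mk] at hab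
  induction b, hab using Nat.le_induction with
  | base => exact .refl _
  | succ m hm ih =>
    have h1 := ih (by omega) fun i hi hi' => h i hi (by simp at hi' ⊢; omega)
    exact h1.trans (Step.skip (i := ⟨m, by omega⟩) d (h _ hm (by simp))).conn

/-- The slices `a` and `b` belong to the same loop. -/
def loopSetoid (e : Fin k → Sym2 Λ) (κ : Fin k → Kind) : Setoid (Λ × Fin (k + 1)) where
  r a b := ∃ d, Conn e κ (a, .up) (b, d)
  iseqv :=
    { refl := fun a => ⟨.up, .refl _⟩
      symm := by
        rintro a b ⟨d, h⟩
        refine ⟨d, ?_⟩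
        -- Multiplying by `d` makes the trajectory arrive at `b` upwards, so that it can be read
        -- backwards from `b`.
        have := (h.flip d).symm
        cases d <;> exact this
      trans := by
        rintro a b c ⟨d, h⟩ ⟨d', h'⟩
        refine ⟨d.mul d', h.trans ?_⟩
        have := h'.flip d
        rwa [Dir.mul_up] at this }

/-- The discrete loops. -/
abbrev LoopQuot (e : Fin k → Sym2 Λ) (κ : Fin k → Kind) : Type _ := Quotient (loopSetoid e κ)

lemma loopQuot_eq_iff {a b : Λ × Fin (k + 1)} :
    (Quotient.mk (loopSetoid e κ) a = Quotient.mk (loopSetoid e κ) b) ↔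
      ∃ d, Conn e κ (a, .up) (b, d) :=
  Quotient.eq

/-! ### Labelings of the loops -/

variable {n : ℕ}

/-- The value seen in direction `d` of a label. -/
def Dir.act (ι : Fin (n + 1) → Fin (n + 1)) : Dir → Fin (n + 1) → Fin (n + 1)
  | .up, a => a
  | .down, a => ι a

lemma Dir.act_act {ι : Fin (n + 1) → Fin (n + 1)} (hι : Function.Involutive ι) (d d' : Dir)
    (a : Fin (n + 1)) : d.act ι (d'.act ι a) = (d.mul d').act ι a := by
  cases d <;> cases d' <;> simp [Dir.act, Dir.mul, hι a]

/-- Labelings of the slices that are constant along trajectories, up to the action of the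
involution upon reversal of the direction. -/
def IsLabeling (e : Fin k → Sym2 Λ) (κ : Fin k → Kind) (ι : Fin (n + 1) → Fin (n + 1))
    (s : Λ × Fin (k + 1) → Fin (n + 1)) : Prop :=
  ∀ a b, Conn e κ a b → a.2.act ι (s a.1) = b.2.act ι (s b.1)

/-- Invariance along trajectories need only be tested on the generators: `wrap` gives periodicity in
time, and the other steps at the transition `i` give its compatibility condition. -/
lemma isLabeling_iff {ι : Fin (n + 1) → Fin (n + 1)}
    (s : Λ × Fin (k + 1) → Fin (n + 1)) :
    IsLabeling e κ ι s ↔ (fun z => s (z, Fin.last k)) = (fun z => s (z, 0)) ∧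
      ∀ i : Fin k, Compat ι (e i) (κ i) (fun z => s (z, i.castSucc))
        fun z => s (z, i.succ) := by
  constructor
  · intro h
    refine ⟨funext fun z => h _ _ (Step.wrap z .up).conn, fun i => ⟨fun z hz =>
      h _ _ (Step.skip .up hz).conn, ?_⟩⟩
    cases hκ : κ i with
    | cross =>
      intro x y hxy
      exact (h _ _ (Step.cross .up (hxy.trans Sym2.eq_swap) hκ).conn).symm
    | bar =>
      intro x y hxy
      exact ⟨(h _ _ (Step.barAbove hxy hκ).conn).symm,
        h _ _ (Step.barBelow (hxy.trans Sym2.eq_swap) hκ).conn⟩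
  · rintro ⟨h1, h2⟩ a b hab
    induction hab with
    | rel a b h =>
      cases h with
      | @skip z i d h => exact congrArg (d.act ι) ((h2 i).1 z h)
      | @cross x y i d h hκ =>
        have := (h2 i).2
        rw [hκ] at this
        exact congrArg (d.act ι) (this y x (h.trans Sym2.eq_swap)).symm
      | @barBelow x y i h hκ =>
        have := (h2 i).2
        rw [hκ] at this
        exact (this y x (h.trans Sym2.eq_swap)).2
      | @barAbove x y i h hκ =>
        have := (h2 i).2
        rw [hκ] at this
        exact (this x y h).1.symm
      | wrap z d => exact congrArg (d.act ι) (congrFun h1 z)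
    | refl a => rfl
    | symm a b _ ih => exact ih.symm
    | trans a b c _ _ ih ih' => exact ih.trans ih'

variable [Fintype Λ] [DecidableEq Λ]

-- The transition operators have entries 0 and 1, so the sum over closed paths counts those
-- compatible with every transition, and `isLabeling_iff` identifies these with labelings. The
-- factor `A` sits at slice 0, the latest one.
open Classical in
lemma trace_eq_sum_labelings {ι : Fin (n + 1) → Fin (n + 1)}
    (d d' : Fin (n + 1) → ℂ) (x y : Λ) (l : Fin (k + 1)) :
    (oneSite x (Matrix.diagonal d) * insertProd (oneSite y (Matrix.diagonal d')) l
        (List.ofFn fun i => transMat ι (e i) (κ i))).trace =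
      ∑ s : Λ × Fin (k + 1) → Fin (n + 1),
        if IsLabeling e κ ι s then d (s (x, 0)) * d' (s (y, l)) else 0 := by
  rw [oneSite_diagonal, oneSite_diagonal, trace_diagonal_insertProd]
  refine Fintype.sum_equiv ((Equiv.curry (Fin (k + 1)) Λ (Fin (n + 1))).symm.trans
    ((Equiv.prodComm Λ (Fin (k + 1))).arrowCongr (Equiv.refl _)).symm) _ _ fun σ => ?_
  have hl := isLabeling_iff (e := e) (κ := κ) (ι := ι)
    (((Equiv.curry (Fin (k + 1)) Λ (Fin (n + 1))).symm.trans
    ((Equiv.prodComm Λ (Fin (k + 1))).arrowCongr (Equiv.refl _)).symm) σ)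
  simp only [hl, transMat, Matrix.of_apply, Finset.prod_ite_zero, Finset.prod_const_one,
    Finset.mem_univ, true_imp_iff]
  change (if σ (Fin.last k) = σ 0 then _ else _) = (if σ (Fin.last k) = σ 0 ∧
    (∀ i, Compat ι (e i) (κ i) (σ i.castSucc) (σ i.succ)) then d (σ 0 x) * d' (σ l y) else 0)
  split_ifs <;> simp_all

end Discrete


/-! ### Rotations of a coordinate plane -/

section Plane

variable {n : ℕ}

/-- The matrix `|p⟩⟨q| + η |q⟩⟨p|`. -/
def planeMat (η : ℂ) (p q : Fin (n + 1)) : Matrix (Fin (n + 1)) (Fin (n + 1)) ℂ :=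
  Matrix.single p q 1 + η • Matrix.single q p 1

/-- A basis change in the plane of `|p⟩` and `|q⟩`. -/
def planeRot (s : ℂ) (p q : Fin (n + 1)) : Matrix (Fin (n + 1)) (Fin (n + 1)) ℂ :=
  Matrix.of fun a =>
    if a = p then ((√2 : ℝ) : ℂ)⁻¹ • (Pi.single p 1 + s • Pi.single q 1)
    else if a = q then ((√2 : ℝ) : ℂ)⁻¹ • (Pi.single p 1 - s • Pi.single q 1)
    else Pi.single a 1

lemma inv_sqrt_two_mul_self : ((√2 : ℝ) : ℂ)⁻¹ * ((√2 : ℝ) : ℂ)⁻¹ = 1 / 2 := by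
  rw [← mul_inv, ← Complex.ofReal_mul, Real.mul_self_sqrt (by norm_num)]
  norm_num

lemma planeRot_left (s : ℂ) (p q : Fin (n + 1)) :
    planeRot s p q p = ((√2 : ℝ) : ℂ)⁻¹ • (Pi.single p 1 + s • Pi.single q 1) :=
  if_pos rfl

lemma planeRot_right (s : ℂ) {p q : Fin (n + 1)} (hpq : p ≠ q) :
    planeRot s p q q = ((√2 : ℝ) : ℂ)⁻¹ • (Pi.single p 1 - s • Pi.single q 1) :=
  (if_neg hpq.symm).trans (if_pos rfl)

lemma planeRot_of_ne (s : ℂ) {p q a : Fin (n + 1)} (hp : a ≠ p) (hq : a ≠ q) :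
    planeRot s p q a = Pi.single a 1 :=
  (if_neg hp).trans (if_neg hq)

/-- The transpose, not the adjoint, appears: the entries are bilinear products of the rows (1,
±s)/√2. They are orthonormal for s² = 1, and isotropic and dual to each other for s² = −1. -/
lemma planeRot_mul_transpose (s : ℂ) {p q : Fin (n + 1)} (hpq : p ≠ q) (a b : Fin (n + 1)) :
    (planeRot s p q * (planeRot s p q).transpose) a b =
      if a = p then (if b = p then (1 + s ^ 2) / 2 else if b = q then (1 - s ^ 2) / 2 else 0)
      else if a = q then
        (if b = p then (1 - s ^ 2) / 2 else if b = q then (1 + s ^ 2) / 2 else 0)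
      else if a = b then 1 else 0 := by
  have h2 := inv_sqrt_two_mul_self
  rw [Matrix.mul_apply']
  change (planeRot s p q a) ⬝ᵥ (planeRot s p q b) = _
  have hL := planeRot_left s p q
  have hR := planeRot_right s hpq
  generalize ((√2 : ℝ) : ℂ)⁻¹ = r at *
  by_cases hap : a = p
  · subst hap
    by_cases hba : b = a
    · subst hba
      simp only [hL, if_true]
      simp [hpq, hpq.symm]
      linear_combination (1 + s ^ 2) * h2
    by_cases hbq : b = q
    · subst hbq
      simp only [hL, hR, if_true, if_neg hba]
      simp [hpq, hpq.symm]
      linear_combination (1 - s ^ 2) * h2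
    simp only [hL, planeRot_of_ne s hba hbq, if_true, if_neg hba, if_neg hbq]
    simp [hba, hbq]
  by_cases haq : a = q
  · subst haq
    by_cases hbp : b = p
    · subst hbp
      simp only [hL, hR, if_true, if_neg hap]
      simp [hpq, hpq.symm]
      linear_combination (1 - s ^ 2) * h2
    by_cases hba : b = a
    · subst hba
      simp only [hR, if_true, if_neg hap]
      simp [hpq, hpq.symm]
      linear_combination (1 + s ^ 2) * h2
    simp only [hR, planeRot_of_ne s hbp hba, if_true, if_neg hap, if_neg hba, if_neg hbp]
    simp [hba, hbp]
  simp only [planeRot_of_ne s hap haq, if_neg hap, if_neg haq, single_dotProduct, one_mul]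
  by_cases hbp : b = p
  · subst hbp
    simp [hL, hap, haq]
  by_cases hbq : b = q
  · subst hbq
    simp [hR, hap, haq]
  simp [planeRot_of_ne s hbp hbq, Pi.single_apply]

lemma planeRot_one_mul_transpose {p q : Fin (n + 1)} (hpq : p ≠ q) :
    planeRot 1 p q * (planeRot 1 p q).transpose = involMat id := by
  ext a b
  rw [planeRot_mul_transpose _ hpq]
  simp only [involMat, Matrix.of_apply, id, @eq_comm _ b a]
  by_cases hap : a = p
  · subst hap
    by_cases hab : a = b
    · simp [hab]
    · simp [hab, Ne.symm hab]
  by_cases haq : a = q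
  · subst haq
    by_cases hab : a = b
    · subst hab; simp [hap]
    · simp [hap, hab, Ne.symm hab]
  simp [hap, haq]

lemma planeRot_I_mul_transpose {p q : Fin (n + 1)} (hpq : p ≠ q) :
    planeRot (-Complex.I) p q * (planeRot (-Complex.I) p q).transpose =
      involMat (Equiv.swap p q) := by
  ext a b
  rw [planeRot_mul_transpose _ hpq]
  simp only [involMat, Matrix.of_apply]
  by_cases hap : a = p
  · subst hap
    rw [Equiv.swap_apply_left]
    by_cases hba : b = a
    · subst hba; simp [hpq]
    · simp [hba]
  by_cases haq : a = q
  · subst haq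
    rw [Equiv.swap_apply_right]
    by_cases hbp : b = p
    · subst hbp; simp [hap]
    · simp [hap, hbp]
  rw [Equiv.swap_apply_of_ne_of_ne hap haq]
  simp [hap, haq, eq_comm]

/-- The difference of the indicators of `p` and `q`. -/
def planeDiff (p q : Fin (n + 1)) : Fin (n + 1) → ℂ := Pi.single p 1 - Pi.single q 1

lemma mul_planeMat (V : Matrix (Fin (n + 1)) (Fin (n + 1)) ℂ) (η : ℂ) (p q a b : Fin (n + 1)) :
    (V * planeMat η p q) a b =
      (if b = q then V a p else 0) + η * if b = p then V a q else 0 := by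
  rw [planeMat, mul_add, Matrix.add_apply, Matrix.mul_smul, Matrix.smul_apply]
  simp only [Matrix.mul_apply, Matrix.single_apply, smul_eq_mul]
  congr 2
  · rw [Finset.sum_eq_single p (by intro c _ hc; simp [hc.symm]) (by simp)]
    simp [eq_comm]
  · rw [Finset.sum_eq_single q (by intro c _ hc; simp [hc.symm]) (by simp)]
    simp [eq_comm]

/-- The rows (1, ±s)/√2 are left eigenvectors of the plane matrix, with eigenvalues ±sη. -/
lemma planeRot_mul_planeMat {s η : ℂ} (hs : s ^ 2 = η) (hη : η ^ 2 = 1) {p q : Fin (n + 1)}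
    (hpq : p ≠ q) :
    planeRot s p q * planeMat η p q =
      Matrix.diagonal ((s * η) • planeDiff p q) * planeRot s p q := by
  ext a b
  rw [Matrix.diagonal_mul, mul_planeMat]
  have hL := planeRot_left s p q
  have hR := planeRot_right s hpq
  generalize ((√2 : ℝ) : ℂ)⁻¹ = r at *
  have hc : s * η * s = 1 := by rw [← hη, ← hs]; ring
  by_cases hap : a = p
  · subst hap
    simp only [hL, planeDiff]
    by_cases hba : b = a
    · subst hba
      simp [hpq, hpq.symm]
      ring
    by_cases hbq : b = q
    · subst hbq
      simp [hpq, hpq.symm]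
      linear_combination - r * hc
    simp [hpq, hba, hbq]
  by_cases haq : a = q
  · subst haq
    simp only [hR, planeDiff]
    by_cases hba : b = a
    · subst hba
      simp [hpq, hpq.symm]
      linear_combination - r * hc
    by_cases hbp : b = p
    · subst hbp
      simp [hpq, hpq.symm]
      ring
    simp [hpq.symm, hba, hbp]
  simp [planeRot_of_ne s hap haq, planeDiff, hap, haq, Ne.symm hap, Ne.symm haq]

/-- The diagonal matrix that changes the sign of `|a⟩`. -/
def signVec (a : Fin (n + 1)) : Fin (n + 1) → ℂ := fun b => if b = a then -1 else 1

lemma signVec_mul_self (a b : Fin (n + 1)) : signVec a b * signVec a b = 1 := by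
  unfold signVec
  split_ifs <;> norm_num

lemma signVec_mul_transpose (a : Fin (n + 1)) :
    Matrix.diagonal (signVec a) * (Matrix.diagonal (signVec a)).transpose = involMat id := by
  rw [Matrix.diagonal_transpose, Matrix.diagonal_mul_diagonal]
  ext b c
  simp [signVec_mul_self, Matrix.diagonal_apply, involMat, eq_comm]

/-- Conjugation by a sign change multiplies the plane matrix by −1 when `a` is exactly one of `p`,
`q`; this is what separates different planes. -/
lemma signVec_mul_planeMat (a : Fin (n + 1)) (η : ℂ) (p q : Fin (n + 1)) :
    Matrix.diagonal (signVec a) * planeMat η p q =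
      ((signVec a p * signVec a q) • planeMat η p q) * Matrix.diagonal (signVec a) := by
  ext b c
  rw [mul_planeMat, Matrix.mul_diagonal]
  simp only [planeMat, Matrix.smul_apply, Matrix.add_apply, Matrix.single_apply,
    Matrix.diagonal_apply, smul_eq_mul]
  have hp := signVec_mul_self a p
  have hq := signVec_mul_self a q
  by_cases hbp : b = p
  · subst hbp
    by_cases hcq : c = q
    · subst hcq
      by_cases hbc : b = c
      · subst hbc
        simp
        linear_combination (-(signVec a b) - η * signVec a b) * hp
      · simp [hbc, Ne.symm hbc]
        linear_combination (-(signVec a b)) * hq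
    · by_cases hbq : b = q
      · subst hbq
        simp [hcq, Ne.symm hcq]
      · simp [hcq, Ne.symm hcq, hbq, Ne.symm hbq]
  · by_cases hbq : b = q
    · subst hbq
      by_cases hcp : c = p
      · subst hcp
        simp [hbp, Ne.symm hbp]
        linear_combination (-η * signVec a b) * hp
      · simp [hbp, Ne.symm hbp, hcp, Ne.symm hcp]
    · simp [hbp, Ne.symm hbp, hbq, Ne.symm hbq]

end Plane


/-! ### Sums over labelings -/

section Sums

variable {Λ : Type*} {k n : ℕ} [Fintype Λ] [DecidableEq Λ]
  {e : Fin k → Sym2 Λ} {κ : Fin k → Kind}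

/-- A slice is never connected to itself with the reverse direction: an odd labeling with two
labels exists since the number of these is the number of even labelings. -/
lemma not_conn_reverse (he : ∀ i, ¬ (e i).IsDiag) (a : Λ × Fin (k + 1)) :
    ¬ Conn e κ (a, .up) (a, .down) := by
  classical
  have hinv : Function.Involutive (Equiv.swap (0 : Fin 2) 1) := fun b => by simp
  -- With both insertions equal to 1, the two traces are the numbers of labelings for `id` and for
  -- the swap.
  have h1 := trace_oneSite_insertProd_conj (n := 1) (A := 1) (A' := 1) (B := 1) (B' := 1) hinv
    (planeRot_I_mul_transpose (n := 1) (p := 0) (q := 1) (by decide)) (by simp) (by simp)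
    he κ 0 a.1 a.1
  rw [← Matrix.diagonal_one] at h1
  have h2 := trace_eq_sum_labelings (e := e) (κ := κ) (ι := (id : Fin 2 → Fin 2)) 1 1 a.1 a.1 0
  have h3 := trace_eq_sum_labelings (e := e) (κ := κ) (ι := Equiv.swap (0 : Fin 2) 1)
    1 1 a.1 a.1 0
  have h4 := h2.symm.trans (h1.trans h3)
  simp only [Pi.one_apply, mul_one, Finset.sum_boole, Nat.cast_inj] at h4
  -- The constant labeling is even, so an odd labeling exists as well; a slice connected to its own
  -- reverse would then carry a label fixed by the swap of two labels.
  have h5 : 0 < (Finset.univ.filter fun s : Λ × Fin (k + 1) → Fin 2 =>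
      IsLabeling e κ id s).card := by
    refine Finset.card_pos.2 ⟨fun _ => 0, ?_⟩
    simp only [Finset.mem_filter, Finset.mem_univ, true_and]
    rintro ⟨b, _ | _⟩ ⟨c, _ | _⟩ _ <;> rfl
  rw [h4] at h5
  obtain ⟨s, hs⟩ := Finset.card_pos.1 h5
  intro hc
  have h6 := (Finset.mem_filter.1 hs).2 _ _ hc
  simp only [Dir.act] at h6
  generalize s a = v at h6
  fin_cases v <;> simp at h6

/-- The direction in which the trajectory going up from the representative of a loop visits a
slice. -/
def loopDir (e : Fin k → Sym2 Λ) (κ : Fin k → Kind) (a : Λ × Fin (k + 1)) : Dir :=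
  (loopQuot_eq_iff.1 (Quotient.out_eq (Quotient.mk (loopSetoid e κ) a))).choose

omit [Fintype Λ] [DecidableEq Λ] in
lemma conn_loopDir (a : Λ × Fin (k + 1)) :
    Conn e κ ((Quotient.mk (loopSetoid e κ) a).out, .up) (a, loopDir e κ a) :=
  (loopQuot_eq_iff.1 (Quotient.out_eq (Quotient.mk (loopSetoid e κ) a))).choose_spec

/-- Two different directions at `b` would connect `b` to its own reverse. -/
lemma Conn.dir_eq (he : ∀ i, ¬ (e i).IsDiag) {a b : Λ × Fin (k + 1)} {d d' d'' : Dir}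
    (h : Conn e κ (a, d) (b, d')) (h' : Conn e κ (a, d) (b, d'')) : d' = d'' := by
  have h1 := h.symm.trans h'
  cases d' <;> cases d''
  · rfl
  · exact absurd h1 (not_conn_reverse he b)
  · exact absurd h1.symm (not_conn_reverse he b)
  · rfl

/-- Labelings correspond to choices of a label for every loop. -/
def labelingEquiv (he : ∀ i, ¬ (e i).IsDiag) {ι : Fin (n + 1) → Fin (n + 1)}
    (hι : Function.Involutive ι) :
    {s : Λ × Fin (k + 1) → Fin (n + 1) // IsLabeling e κ ι s} ≃
      (LoopQuot e κ → Fin (n + 1)) where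
  toFun s q := s.1 q.out
  invFun f := ⟨fun a => (loopDir e κ a).act ι (f (Quotient.mk _ a)), by
    rintro ⟨a, d⟩ ⟨b, d'⟩ h
    have hq : Quotient.mk (loopSetoid e κ) a = Quotient.mk (loopSetoid e κ) b := by
      refine loopQuot_eq_iff.2 ⟨d.mul d', ?_⟩
      have := h.flip d
      cases d <;> exact this
    simp only [Dir.act_act hι]
    -- Both trajectories leave the representative of the common loop and are turned so as to end at
    -- `(a, d)` and `(b, d')`; since these are connected, the starting directions coincide.
    have h1 := (conn_loopDir (e := e) (κ := κ) a).flip (d.mul (loopDir e κ a))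
    have h2 := (conn_loopDir (e := e) (κ := κ) b).flip (d'.mul (loopDir e κ b))
    simp only [Dir.mul_mul_self, Dir.mul_up] at h1 h2
    rw [← hq] at h2
    rw [hq, (Conn.refl _).dir_eq he ((h1.trans h).trans h2.symm)]⟩
  left_inv s := by
    ext a
    have h1 := s.2 _ _ (conn_loopDir (e := e) (κ := κ) a)
    simp only [Dir.act] at h1 ⊢
    rw [h1]
    cases loopDir e κ a <;> simp [hι (s.1 a)]
  right_inv f := by
    ext q
    have h1 := conn_loopDir (e := e) (κ := κ) q.out
    rw [Quotient.out_eq] at h1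
    have h2 := (Conn.refl _).dir_eq he h1
    simp only [← h2, Dir.act, Quotient.out_eq]

instance : Finite (LoopQuot e κ) := Quotient.finite _

/-- Labels of different loops are summed independently and each has sum zero against `d`; for a
single loop the remaining card Q − 1 labels are free. -/
lemma sum_fun_mul {Q L : Type*} [Fintype Q] [DecidableEq Q] [Fintype L] (d : L → ℂ)
    (hd : ∑ a, d a = 0) (q q' : Q) :
    ∑ f : Q → L, d (f q) * d (f q') =
      if q = q' then (∑ a, d a ^ 2) * (Fintype.card L : ℂ) ^ (Fintype.card Q - 1) else 0 := by
  rw [← (Equiv.funSplitAt q L).symm.sum_comp, Fintype.sum_prod_type]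
  split_ifs with h
  · subst h
    have hc : Fintype.card {j // j ≠ q} = Fintype.card Q - 1 := by
      simp [Fintype.card_subtype_compl]
    simp only [Equiv.funSplitAt_symm_apply, dif_pos, Finset.sum_const, Finset.card_univ,
      Fintype.card_fun, hc, nsmul_eq_mul, Finset.sum_mul]
    refine Finset.sum_congr rfl fun a _ => ?_
    push_cast
    ring
  · rw [Finset.sum_comm]
    refine Finset.sum_eq_zero fun g _ => ?_
    simp only [Equiv.funSplitAt_symm_apply, dif_pos, dif_neg (Ne.symm h), ← Finset.sum_mul, hd,
      zero_mul]

/-- The number `1[E⁺] + η 1[E⁻]`. -/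
def connSign (e : Fin k → Sym2 Λ) (κ : Fin k → Kind) (η : ℂ) (a b : Λ × Fin (k + 1)) : ℂ :=
  open Classical in
  (if Conn e κ (a, .up) (b, .up) then 1 else 0) +
    η * if Conn e κ (a, .up) (b, .down) then 1 else 0

-- Each slice reads the label of its loop, with a factor η if it is visited downwards. As η² = 1,
-- the product of two readings in one loop is d² times η to the relative reversal, which is
-- `connSign`.
open Classical in
lemma sum_labelings_mul (he : ∀ i, ¬ (e i).IsDiag) {ι : Fin (n + 1) → Fin (n + 1)}
    (hι : Function.Involutive ι) {d : Fin (n + 1) → ℂ} {η : ℂ} (hη : η ^ 2 = 1)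
    (hd : ∑ a, d a = 0) (hdι : ∀ a, d (ι a) = η * d a) (a b : Λ × Fin (k + 1)) :
    (∑ s : Λ × Fin (k + 1) → Fin (n + 1),
        if IsLabeling e κ ι s then d (s a) * d (s b) else 0) =
      connSign e κ η a b * (∑ c, d c ^ 2) * ((n : ℂ) + 1) ^ (Nat.card (LoopQuot e κ) - 1) := by
  have : Fintype (LoopQuot e κ) := Fintype.ofFinite _
  rw [← Finset.sum_filter, Finset.sum_subtype (p := IsLabeling e κ ι) _ (by simp),
    ← (labelingEquiv he hι).symm.sum_comp]
  have hC := conn_loopDir (e := e) (κ := κ) a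
  have hC' := conn_loopDir (e := e) (κ := κ) b
  have hnot : Quotient.mk (loopSetoid e κ) a ≠ Quotient.mk (loopSetoid e κ) b →
      ∀ δ, ¬ Conn e κ (a, .up) (b, δ) := fun h δ hc => h (loopQuot_eq_iff.2 ⟨δ, hc⟩)
  -- The path from `a` to `b` through the representative of the loop.
  have hyes : Quotient.mk (loopSetoid e κ) a = Quotient.mk (loopSetoid e κ) b →
      Conn e κ (a, .up) (b, (loopDir e κ a).mul (loopDir e κ b)) := fun h => by
    rw [← h] at hC'
    have := (hC.symm.trans hC').flip (loopDir e κ a)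
    rwa [show ∀ δ : Dir, δ.mul δ = .up by rintro (_ | _) <;> rfl] at this
  have hsum := sum_fun_mul d hd (Quotient.mk (loopSetoid e κ) a) (Quotient.mk (loopSetoid e κ) b)
  rw [Fintype.card_fin, ← Nat.card_eq_fintype_card] at hsum
  push_cast at hsum
  have hval : ∀ f : LoopQuot e κ → Fin (n + 1), ∀ c, ((labelingEquiv he hι).symm f).1 c =
      (loopDir e κ c).act ι (f (Quotient.mk _ c)) := fun _ _ => rfl
  simp only [hval]
  have hd1 : ∀ c, d (Dir.up.act ι c) = d c := fun _ => rfl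
  have hd2 : ∀ c, d (Dir.down.act ι c) = η * d c := hdι
  by_cases hq : Quotient.mk (loopSetoid e κ) a = Quotient.mk (loopSetoid e κ) b
  · have h1 := hyes hq
    rw [if_pos hq] at hsum
    have hup : Conn e κ (a, .up) (b, .up) ↔ (loopDir e κ a).mul (loopDir e κ b) = .up :=
      ⟨fun h => h1.dir_eq he h, fun h => h ▸ h1⟩
    have hdown : Conn e κ (a, .up) (b, .down) ↔ (loopDir e κ a).mul (loopDir e κ b) = .down :=
      ⟨fun h => h1.dir_eq he h, fun h => h ▸ h1⟩
    simp only [connSign, hup, hdown]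
    cases loopDir e κ a <;> cases loopDir e κ b <;>
      simp only [hd1, hd2, Dir.mul, reduceCtorEq, if_true, if_false]
    · rw [hsum]; ring
    · simp only [mul_left_comm _ η, ← Finset.mul_sum, hsum]; ring
    · simp only [mul_assoc, ← Finset.mul_sum, hsum]; ring
    · have : ∀ u v : ℂ, η * u * (η * v) = u * v := fun u v => by
        linear_combination (u * v) * hη
      simp only [this, hsum]; ring
  · rw [if_neg hq] at hsum
    simp only [connSign, if_neg (hnot hq _), mul_zero, add_zero, zero_mul]
    cases loopDir e κ a <;> cases loopDir e κ b <;> simp only [hd1, hd2]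
    · exact hsum
    · simp only [mul_left_comm _ η, ← Finset.mul_sum, hsum, mul_zero]
    · simp only [mul_assoc, ← Finset.mul_sum, hsum, mul_zero]
    · have : ∀ u v : ℂ, η * u * (η * v) = u * v := fun u v => by
        linear_combination (u * v) * hη
      simp only [this, hsum]

/-- The trace of an ordered product of transition operators is `θ` to the number of loops. -/
lemma trace_prod_transMat (he : ∀ i, ¬ (e i).IsDiag) (x : Λ) (l : Fin (k + 1)) :
    ((1 : Op Λ n) * insertProd 1 l
        (List.ofFn fun i => transMat id (e i) (κ i))).trace =
      ((n : ℂ) + 1) ^ Nat.card (LoopQuot e κ) := by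
  classical
  have : Fintype (LoopQuot e κ) := Fintype.ofFinite _
  have h2 := trace_eq_sum_labelings (e := e) (κ := κ) (ι := (id : Fin (n + 1) → Fin (n + 1)))
    1 1 x x l
  have h1 : Matrix.diagonal (1 : Fin (n + 1) → ℂ) = 1 := Matrix.diagonal_one
  rw [h1, oneSite_one] at h2
  rw [h2]
  simp only [Pi.one_apply, mul_one, Finset.sum_boole]
  rw [← Fintype.card_subtype, Fintype.card_congr (labelingEquiv he (fun _ => rfl))]
  simp

end Sums


/-! ### Spin operators inserted in ordered products -/

section SpinTraces

variable {Λ : Type*} {k n : ℕ} [Fintype Λ] [DecidableEq Λ]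
  {e : Fin k → Sym2 Λ} {κ : Fin k → Kind}

/-- The trace of an ordered product of transition operators with two one-site insertions. -/
def insertTrace (n : ℕ) (e : Fin k → Sym2 Λ) (κ : Fin k → Kind) (x y : Λ) (l : Fin (k + 1)) :
    Matrix (Fin (n + 1)) (Fin (n + 1)) ℂ →ₗ[ℂ] Matrix (Fin (n + 1)) (Fin (n + 1)) ℂ →ₗ[ℂ] ℂ :=
  LinearMap.mk₂ ℂ (fun A B => (oneSite x A * insertProd (oneSite y B) l
      (List.ofFn fun i => transMat id (e i) (κ i))).trace)
    (fun A A' B => by rw [oneSite_add, add_mul, Matrix.trace_add])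
    (fun c A B => by rw [oneSite_smul, smul_mul_assoc, Matrix.trace_smul])
    (fun A B B' => by rw [oneSite_add, insertProd_add, mul_add, Matrix.trace_add])
    (fun c A B => by rw [oneSite_smul, insertProd_smul, mul_smul_comm, Matrix.trace_smul])

/-- Changing the sign of |a⟩ at every site is orthogonal, so it preserves all transition operators;
it negates the first insertion and fixes the second, so the trace equals its own negative. -/
lemma insertTrace_planeMat_eq_zero (he : ∀ i, ¬ (e i).IsDiag) (x y : Λ) (l : Fin (k + 1))
    (η : ℂ) {p q p' q' a : Fin (n + 1)} (h : signVec a p * signVec a q = -1)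
    (h' : signVec a p' * signVec a q' = 1) :
    insertTrace n e κ x y l (planeMat η p q) (planeMat η p' q') = 0 := by
  have h1 := signVec_mul_planeMat a η p q
  have h2 := signVec_mul_planeMat a η p' q'
  rw [h] at h1
  rw [h', one_smul] at h2
  have h3 := trace_oneSite_insertProd_conj (fun _ => rfl) (signVec_mul_transpose a) h1 h2 he κ l x y
  have h4 : insertTrace n e κ x y l (planeMat η p q) (planeMat η p' q') =
      insertTrace n e κ x y l ((-1 : ℂ) • planeMat η p q) (planeMat η p' q') := h3
  rw [map_smul, LinearMap.smul_apply, smul_eq_mul] at h4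
  linear_combination (1 / 2 : ℂ) * h4

lemma sum_planeDiff (p q : Fin (n + 1)) : ∑ a, planeDiff p q a = 0 := by
  simp [planeDiff]

lemma sum_planeDiff_sq {p q : Fin (n + 1)} (hpq : p ≠ q) : ∑ a, planeDiff p q a ^ 2 = 2 := by
  have h : ∀ a, planeDiff p q a ^ 2 = (if a = p then 1 else 0) + if a = q then 1 else 0 := by
    intro a
    simp only [planeDiff, Pi.sub_apply, Pi.single_apply]
    by_cases hp : a = p
    · subst hp; simp [hpq]
    · simp [hp]
  simp only [h, Finset.sum_add_distrib, Finset.sum_ite_eq', Finset.mem_univ, if_true]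
  norm_num

/-- In the rotated basis both insertions equal sη times the difference of two indicators: (sη)² = η,
and the squares of this difference sum to 2. -/
lemma insertTrace_planeMat_self (he : ∀ i, ¬ (e i).IsDiag) (x y : Λ) (l : Fin (k + 1))
    {η : ℂ} (hη : η = 1 ∨ η = -1) {p q : Fin (n + 1)} (hpq : p ≠ q) :
    insertTrace n e κ x y l (planeMat η p q) (planeMat η p q) =
      2 * η * connSign e κ η (x, 0) (y, l) *
        ((n : ℂ) + 1) ^ (Nat.card (LoopQuot e κ) - 1) := by
  classical
  have hη2 : η ^ 2 = 1 := by rcases hη with rfl | rfl <;> norm_num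
  -- The parameter s is a square root of η. For η = −1 it is imaginary and V Vᵀ is a swap, under
  -- which the difference of indicators is odd.
  obtain ⟨s, ι, hι, hs, hV, hd⟩ : ∃ (s : ℂ) (ι : Fin (n + 1) → Fin (n + 1)),
      Function.Involutive ι ∧ s ^ 2 = η ∧
      planeRot s p q * (planeRot s p q).transpose = involMat ι ∧
      ∀ a, planeDiff p q (ι a) = η * planeDiff p q a := by
    rcases hη with rfl | rfl
    · exact ⟨1, id, fun _ => rfl, by norm_num, planeRot_one_mul_transpose hpq, by simp⟩
    · refine ⟨-Complex.I, Equiv.swap p q, fun a => by simp, by simp,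
        planeRot_I_mul_transpose hpq, fun a => ?_⟩
      simp only [planeDiff, Pi.sub_apply, Pi.single_apply]
      by_cases hp : a = p
      · subst hp; simp [hpq, hpq.symm]
      by_cases hq : a = q
      · subst hq; simp [hpq, hp]
      rw [Equiv.swap_apply_of_ne_of_ne hp hq]
      simp [hp, hq]
  have h1 := planeRot_mul_planeMat hs hη2 hpq
  have h3 := trace_oneSite_insertProd_conj hι hV h1 h1 he κ l x y
  refine h3.trans ?_
  rw [trace_eq_sum_labelings]
  have h4 := sum_labelings_mul (e := e) (κ := κ) he hι hη2 (sum_planeDiff p q) hd (x, 0) (y, l)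
  rw [sum_planeDiff_sq hpq] at h4
  have h5 : ∀ u v : ℂ, (s * η * u) * (s * η * v) = η * (u * v) := fun u v => by
    linear_combination (u * v * η ^ 2) * hs + (η * u * v) * hη2
  have h6 : ∀ (P : Prop) [Decidable P] (v : ℂ),
      (if P then η * v else 0) = η * if P then v else 0 := fun P _ v => by
    split_ifs <;> simp
  simp only [Pi.smul_apply, smul_eq_mul, h5, h6, ← Finset.mul_sum, h4]
  ring

/-- The coefficients of the raising operator. -/
def raiseCoeff (n : ℕ) (i : Fin n) : ℝ :=
  Real.sqrt (spin n * (spin n + 1) - spinValue n i.castSucc * (spinValue n i.castSucc + 1))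

lemma raise_radicand (n : ℕ) (i : Fin n) :
    spin n * (spin n + 1) - spinValue n i.castSucc * (spinValue n i.castSucc + 1) =
      ((n : ℝ) - i) * (i + 1) := by
  simp only [spin, spinValue, Fin.val_castSucc]
  ring

lemma raiseCoeff_sq (n : ℕ) (i : Fin n) : raiseCoeff n i ^ 2 = ((n : ℝ) - i) * (i + 1) := by
  rw [raiseCoeff, raise_radicand, Real.sq_sqrt]
  have : ((i : ℕ) : ℝ) ≤ n := by exact_mod_cast i.2.le
  have : (0 : ℝ) ≤ n - (i : ℕ) := by linarith
  positivity

lemma sum_raiseCoeff_sq (n : ℕ) :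
    ∑ i, raiseCoeff n i ^ 2 = 2 / 3 * spin n * (spin n + 1) * (n + 1) := by
  -- `N` is kept apart from the length `m`, so that the induction changes only the latter.
  have h : ∀ (N : ℝ) (m : ℕ), ∑ i ∈ Finset.range m, (N - i) * ((i : ℝ) + 1) =
      N * m + (N - 1) * (m * (m - 1) / 2) - (m - 1) * m * (2 * m - 1) / 6 := by
    intro N m
    induction m with
    | zero => simp
    | succ m ih =>
      rw [Finset.sum_range_succ, ih]
      push_cast
      ring
  simp only [raiseCoeff_sq]
  rw [Fin.sum_univ_eq_sum_range (fun i : ℕ => ((n : ℝ) - i) * ((i : ℝ) + 1)), h, spin]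
  ring

lemma sum_spinValue (n : ℕ) : ∑ i, spinValue n i = 0 := by
  have h : ∀ (N : ℝ) (m : ℕ), ∑ i ∈ Finset.range m, ((i : ℝ) - N / 2) =
      m * (m - 1) / 2 - m * (N / 2) := by
    intro N m
    induction m with
    | zero => simp
    | succ m ih =>
      rw [Finset.sum_range_succ, ih]
      push_cast
      ring
  simp only [spinValue, spin]
  rw [Fin.sum_univ_eq_sum_range (fun i : ℕ => (i : ℝ) - n / 2), h]
  push_cast
  ring

lemma sum_spinValue_sq (n : ℕ) :
    ∑ i, spinValue n i ^ 2 = 1 / 3 * spin n * (spin n + 1) * (n + 1) := by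
  have h : ∀ (N : ℝ) (m : ℕ), ∑ i ∈ Finset.range m, ((i : ℝ) - N / 2) ^ 2 =
      (m - 1) * m * (2 * m - 1) / 6 - N * (m * (m - 1) / 2) + m * (N / 2) ^ 2 := by
    intro N m
    induction m with
    | zero => simp
    | succ m ih =>
      rw [Finset.sum_range_succ, ih]
      push_cast
      ring
  simp only [spinValue, spin]
  rw [Fin.sum_univ_eq_sum_range (fun i : ℕ => ((i : ℝ) - n / 2) ^ 2), h]
  push_cast
  ring

lemma spinPlus_add_smul_spinMinus (n : ℕ) (η : ℂ) :
    spinPlus n + η • spinMinus n =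
      ∑ i : Fin n, (raiseCoeff n i : ℂ) • planeMat η i.succ i.castSucc := by
  have hp : spinPlus n = ∑ i : Fin n,
      (raiseCoeff n i : ℂ) • Matrix.single i.succ i.castSucc (1 : ℂ) := by
    ext a b
    simp only [Matrix.sum_apply, Matrix.smul_apply, Matrix.single_apply, spinPlus,
      Matrix.of_apply, smul_eq_mul]
    refine Fin.lastCases ?_ (fun j => ?_) b
    -- The highest state has no raised state.
    · rw [if_neg (by have := a.2; simp; omega), Finset.sum_eq_zero]
      intro i _
      rw [if_neg (fun h => absurd h.2 (Fin.castSucc_ne_last i)), mul_zero]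
    · rw [Finset.sum_eq_single j]
      · by_cases h : a = j.succ
        · subst h
          simp [raiseCoeff]
        · rw [if_neg (fun h' => h (Fin.ext (by simpa using h'))),
            if_neg (fun h' => h h'.1.symm), mul_zero]
      · intro i _ hi
        rw [if_neg (fun h => hi (Fin.castSucc_injective _ h.2)), mul_zero]
      · simp
  have hm : spinMinus n = ∑ i : Fin n,
      (raiseCoeff n i : ℂ) • Matrix.single i.castSucc i.succ (1 : ℂ) := by
    rw [spinMinus, hp, Matrix.conjTranspose_sum]
    refine Finset.sum_congr rfl fun i _ => ?_
    rw [Matrix.conjTranspose_smul, Matrix.conjTranspose_single]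
    simp
  rw [hm, hp, Finset.smul_sum, ← Finset.sum_add_distrib]
  refine Finset.sum_congr rfl fun i _ => ?_
  rw [planeMat, smul_add, smul_comm]

/-- Only equal planes survive in the double sum, leaving ∑ c² over the ladder coefficients, which is
twice ∑ a² over the values of S³; this is why all three components share one constant. -/
lemma insertTrace_ladder (he : ∀ i, ¬ (e i).IsDiag) (x y : Λ) (l : Fin (k + 1))
    {η : ℂ} (hη : η = 1 ∨ η = -1) :
    insertTrace n e κ x y l (spinPlus n + η • spinMinus n) (spinPlus n + η • spinMinus n) =
      4 * η * ((1 / 3 * spin n * (spin n + 1) : ℝ) : ℂ) * connSign e κ η (x, 0) (y, l) *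
        (((n : ℂ) + 1) * ((n : ℂ) + 1) ^ (Nat.card (LoopQuot e κ) - 1)) := by
  rw [spinPlus_add_smul_spinMinus]
  simp only [map_sum, LinearMap.sum_apply, map_smul, LinearMap.smul_apply, smul_eq_mul, Finset.mul_sum]
  have h : ∀ i : Fin n, ∑ j : Fin n, (raiseCoeff n i : ℂ) * ((raiseCoeff n j : ℂ) *
      insertTrace n e κ x y l (planeMat η j.succ j.castSucc) (planeMat η i.succ i.castSucc)) =
      ((raiseCoeff n i ^ 2 : ℝ) : ℂ) * (2 * η * connSign e κ η (x, 0) (y, l) *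
        ((n : ℂ) + 1) ^ (Nat.card (LoopQuot e κ) - 1)) := by
    intro i
    rw [Finset.sum_eq_single i]
    · rw [insertTrace_planeMat_self he x y l hη (Fin.castSucc_lt_succ (i := i)).ne']
      push_cast
      ring
    · intro j _ hj
      have : insertTrace n e κ x y l (planeMat η j.succ j.castSucc)
          (planeMat η i.succ i.castSucc) = 0 := by
        have hj' : (j : ℕ) ≠ i := fun h => hj (Fin.ext h)
        -- The vector with changed sign must lie in plane `j` but not in plane `i`: the upper vector
        -- of plane `j`, unless it is also the lower vector of plane `i`, in which case the lower
        -- one.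
        by_cases hij : (j : ℕ) + 1 = i
        · apply insertTrace_planeMat_eq_zero he x y l η (a := j.castSucc)
          · simp [signVec, Fin.ext_iff]
          · simp only [signVec, Fin.ext_iff, Fin.val_succ, Fin.val_castSucc]
            rw [if_neg (by omega), if_neg (by omega), one_mul]
        · apply insertTrace_planeMat_eq_zero he x y l η (a := j.succ)
          · simp [signVec, Fin.ext_iff]
          · simp only [signVec, Fin.ext_iff, Fin.val_succ, Fin.val_castSucc]
            rw [if_neg (by omega), if_neg (by omega), one_mul]
      rw [this, mul_zero, mul_zero]
    · simp
  rw [Finset.sum_congr rfl fun i _ => h i]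
  rw [← Finset.sum_mul, ← Complex.ofReal_sum, sum_raiseCoeff_sq]
  push_cast
  ring

lemma loopQuot_card_pos [Nonempty Λ] : 0 < Nat.card (LoopQuot e κ) := by
  have : Nonempty (LoopQuot e κ) := ⟨Quotient.mk _ (Classical.arbitrary Λ, 0)⟩
  exact Nat.card_pos

lemma pow_loops (x : Λ) : ((n : ℂ) + 1) * ((n : ℂ) + 1) ^ (Nat.card (LoopQuot e κ) - 1) =
    ((n : ℂ) + 1) ^ Nat.card (LoopQuot e κ) := by
  have : Nonempty Λ := ⟨x⟩
  rw [← pow_succ', Nat.sub_add_cancel loopQuot_card_pos]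

lemma insertTrace_spin1 (he : ∀ i, ¬ (e i).IsDiag) (x y : Λ) (l : Fin (k + 1)) :
    insertTrace n e κ x y l (spin1 n) (spin1 n) =
      ((1 / 3 * spin n * (spin n + 1) : ℝ) : ℂ) * (connSign e κ 1 (x, 0) (y, l) *
        ((n : ℂ) + 1) ^ Nat.card (LoopQuot e κ)) := by
  have h := insertTrace_ladder (n := n) (κ := κ) he x y l (Or.inl rfl)
  rw [one_smul, pow_loops x] at h
  rw [spin1, map_smul, map_smul, LinearMap.smul_apply, h]
  simp only [smul_eq_mul]
  ring

lemma insertTrace_spin2 (he : ∀ i, ¬ (e i).IsDiag) (x y : Λ) (l : Fin (k + 1)) :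
    insertTrace n e κ x y l (spin2 n) (spin2 n) =
      ((1 / 3 * spin n * (spin n + 1) : ℝ) : ℂ) * (connSign e κ (-1) (x, 0) (y, l) *
        ((n : ℂ) + 1) ^ Nat.card (LoopQuot e κ)) := by
  have h := insertTrace_ladder (n := n) (κ := κ) he x y l (Or.inr rfl)
  rw [neg_one_smul, ← sub_eq_add_neg, pow_loops x] at h
  rw [spin2, map_smul, map_smul, LinearMap.smul_apply, h]
  simp only [smul_eq_mul]
  -- This factor cancels 4η for η = −1, so the constant is positive as for the other components.
  have hI : (1 / (2 * Complex.I)) * (1 / (2 * Complex.I)) = -1 / 4 := by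
    rw [div_mul_div_comm, mul_mul_mul_comm, Complex.I_mul_I]
    norm_num
  linear_combination (4 * (-1) * ((1 / 3 * spin n * (spin n + 1) : ℝ) : ℂ) *
    connSign e κ (-1) (x, 0) (y, l) * ((n : ℂ) + 1) ^ Nat.card (LoopQuot e κ)) * hI

lemma insertTrace_spin3 (he : ∀ i, ¬ (e i).IsDiag) (x y : Λ) (l : Fin (k + 1)) :
    insertTrace n e κ x y l (spin3 n) (spin3 n) =
      ((1 / 3 * spin n * (spin n + 1) : ℝ) : ℂ) * (connSign e κ 1 (x, 0) (y, l) *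
        ((n : ℂ) + 1) ^ Nat.card (LoopQuot e κ)) := by
  classical
  have h := trace_eq_sum_labelings (e := e) (κ := κ) (ι := (id : Fin (n + 1) → Fin (n + 1)))
    (fun i => (spinValue n i : ℂ)) (fun i => (spinValue n i : ℂ)) x y l
  have h4 := sum_labelings_mul (e := e) (κ := κ) he (fun _ => rfl) (one_pow 2)
    (d := fun i => (spinValue n i : ℂ)) (by rw [← Complex.ofReal_sum, sum_spinValue]; simp)
    (ι := id) (by simp) (x, 0) (y, l)
  refine (h.trans h4).trans ?_
  simp only [← Complex.ofReal_pow]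
  rw [← Complex.ofReal_sum, sum_spinValue_sq, ← pow_loops x]
  push_cast
  ring

end SpinTraces


/-! ### Trajectories in continuous time and discrete trajectories -/

open Classical in
lemma mem_ofSeq {X : Type*} {k : ℕ} {p : Fin k → X} {a : X} :
    a ∈ Config.ofSeq p ↔ ∃ i, p i = a := by
  rw [show (a ∈ Config.ofSeq p) = (a ∈ Finset.univ.image p) from rfl]
  simp

section Trajectories

variable {Λ : Type*} {G : SimpleGraph Λ} {k : ℕ}

/-- The edges of a sequence of transitions. -/
def edgesOf (m : Fin k → Transition G) (i : Fin k) : Sym2 Λ := (m i).1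

/-- The kinds of a sequence of transitions. -/
def kindsOf (m : Fin k → Transition G) (i : Fin k) : Kind := (m i).2.2

lemma edgesOf_not_isDiag (m : Fin k → Transition G) (i : Fin k) : ¬ (edgesOf m i).IsDiag :=
  G.not_isDiag_of_mem_edgeSet (m i).1.2

/-- A sequence of transitions listed backwards in time, at distinct times in `(0, β)`. -/
structure Backwards (β : ℝ) (m : Fin k → Transition G) : Prop where
  anti : StrictAnti fun i => (m i).2.1
  pos : ∀ i, 0 < (m i).2.1
  lt : ∀ i, (m i).2.1 < β

/-- The number of transitions after time `s`, as the index of a slice. -/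
def slice (m : Fin k → Transition G) (s : ℝ) : Fin (k + 1) :=
  ⟨(Finset.univ.filter fun i => s < (m i).2.1).card,
    Nat.lt_succ_of_le ((Finset.card_le_univ _).trans_eq (Fintype.card_fin k))⟩

variable {β : ℝ} {m : Fin k → Transition G}

/-- Since the times decrease, the transitions after `s` form an initial segment of the indices, so
their number determines them. -/
lemma lt_slice_iff (hm : Backwards β m) (s : ℝ) (i : Fin k) :
    (i : ℕ) < slice m s ↔ s < (m i).2.1 := by
  constructor
  · intro h
    by_contra hs
    have hsub : (Finset.univ.filter fun i => s < (m i).2.1) ⊆ Finset.Iio i := by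
      intro j hj
      simp only [Finset.mem_filter, Finset.mem_univ, true_and] at hj
      rw [Finset.mem_Iio]
      by_contra hij
      exact hs (hj.trans_le (hm.anti.antitone (not_lt.1 hij)))
    have := Finset.card_le_card hsub
    rw [Fin.card_Iio] at this
    exact absurd h (not_lt.2 this)
  · intro hs
    have hsub : Finset.Iic i ⊆ Finset.univ.filter fun i => s < (m i).2.1 := by
      intro j hj
      simp only [Finset.mem_filter, Finset.mem_univ, true_and]
      exact hs.trans_le (hm.anti.antitone (Finset.mem_Iic.1 hj))
    have := Finset.card_le_card hsub
    rw [Fin.card_Iic] at this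
    exact this

lemma slice_eq_iff (hm : Backwards β m) {s : ℝ} {a : Fin (k + 1)} :
    slice m s = a ↔ ∀ i : Fin k, (i : ℕ) < a ↔ s < (m i).2.1 := by
  constructor
  · rintro rfl i
    exact lt_slice_iff hm s i
  · intro h
    refine Fin.ext (le_antisymm ?_ ?_)
    · by_contra hlt
      have ha : (a : ℕ) < k := by have := (slice m s).2; omega
      have h1 := (lt_slice_iff hm s ⟨a, ha⟩).1 (not_le.1 hlt)
      exact absurd ((h ⟨a, ha⟩).2 h1) (lt_irrefl _)
    · by_contra hlt
      have ha : (slice m s : ℕ) < k := by have := a.2; omega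
      have h1 := (h ⟨slice m s, ha⟩).1 (not_le.1 hlt)
      exact absurd ((lt_slice_iff hm s ⟨slice m s, ha⟩).2 h1) (lt_irrefl _)

lemma slice_anti {s s' : ℝ} (h : s ≤ s') : slice m s' ≤ slice m s := by
  simp only [slice, Fin.mk_le_mk]
  exact Finset.card_le_card <| Finset.monotone_filter_right _ fun _ _ hi => h.trans_lt hi

lemma slice_zero (hm : Backwards β m) : slice m 0 = Fin.last k :=
  (slice_eq_iff hm).2 fun i => iff_of_true i.2 (hm.pos i)

lemma slice_top (hm : Backwards β m) : slice m β = 0 :=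
  (slice_eq_iff hm).2 fun i => iff_of_false (Nat.not_lt_zero _) (hm.lt i).le.not_gt

/-- The inequality in `slice` is strict, so the time of a transition belongs to the later of the two
slices that it separates. -/
lemma slice_time (hm : Backwards β m) (j : Fin k) : slice m (m j).2.1 = j.castSucc :=
  (slice_eq_iff hm).2 fun _ => hm.anti.lt_iff_gt.symm

/-- The oriented slice of an oriented point. -/
def orientedSlice (m : Fin k → Transition G) (p : OrientedPoint Λ) :
    (Λ × Fin (k + 1)) × Dir :=
  ((p.site, slice m p.time), p.dir)

lemma free_ofSeq {x : Λ} {I : Set ℝ} :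
    Free (Config.ofSeq m) x I ↔ ∀ i, x ∈ edgesOf m i → (m i).2.1 ∉ I := by
  simp only [Free, mem_ofSeq]
  constructor
  · intro h i
    exact h _ ⟨i, rfl⟩
  · rintro h _ ⟨i, rfl⟩
    exact h i

lemma hasTransition_ofSeq {κ : Kind} {x y : Λ} {r : ℝ} :
    HasTransition (Config.ofSeq m) κ x y r ↔
      ∃ j, edgesOf m j = s(x, y) ∧ (m j).2.1 = r ∧ kindsOf m j = κ := by
  simp only [HasTransition, mem_ofSeq]
  constructor
  · rintro ⟨_, ⟨i, rfl⟩, h⟩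
    exact ⟨i, h⟩
  · rintro ⟨i, h⟩
    exact ⟨_, ⟨i, rfl⟩, h⟩

/-- Vertical motion along free pieces, in terms of slices. -/
lemma conn_of_free {x : Λ} {I : Set ℝ} (hx : Free (Config.ofSeq m) x I)
    {a b : Fin (k + 1)} (hab : a ≤ b) (d : Dir)
    (h : ∀ i : Fin k, (a : ℕ) ≤ i → (i : ℕ) < b → (m i).2.1 ∈ I) :
    Conn (edgesOf m) (kindsOf m) ((x, a), d) ((x, b), d) :=
  conn_of_sites hab d fun i hi hi' hz => free_ofSeq.1 hx i hz (h i hi hi')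

lemma conn_of_move (hm : Backwards β m) {a b : OrientedPoint Λ}
    (h : Move β (Config.ofSeq m) a b) :
    Conn (edgesOf m) (kindsOf m) (orientedSlice m a) (orientedSlice m b) := by
  -- Between `s` and a later transition `j` only other sites are affected, so `s` is joined to the
  -- slice just before `j`; `above` is the analogue after `j`.
  have below : ∀ {x : Λ} {s : ℝ} {j : Fin k} (d : Dir), s < (m j).2.1 →
      Free (Config.ofSeq m) x (Ico s (m j).2.1) →
      Conn (edgesOf m) (kindsOf m) ((x, j.succ), d) ((x, slice m s), d) := by
    intro x s j d hs hx
    refine conn_of_free hx ?_ d fun i hi hi' => ?_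
    · exact Fin.le_def.2 ((lt_slice_iff hm s j).2 hs)
    · exact ⟨((lt_slice_iff hm s i).1 hi').le, hm.anti hi⟩
  have above : ∀ {x : Λ} {s : ℝ} {j : Fin k} (d : Dir), (m j).2.1 < s →
      Free (Config.ofSeq m) x (Ioc (m j).2.1 s) →
      Conn (edgesOf m) (kindsOf m) ((x, slice m s), d) ((x, j.castSucc), d) := by
    intro x s j d hs hx
    refine conn_of_free hx ?_ d fun i hi hi' => ?_
    · rw [← slice_time hm j]
      exact slice_anti hs.le
    · exact ⟨hm.anti hi', not_lt.1 fun hlt => absurd ((lt_slice_iff hm s i).2 hlt) hi.not_gt⟩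
  cases h with
  | @up x s s' h₀ h h₁ hx =>
    refine (conn_of_free hx (slice_anti h) _ fun i hi hi' => ?_).symm
    exact ⟨((lt_slice_iff hm s i).1 hi').le,
      not_lt.1 fun hlt => absurd ((lt_slice_iff hm s' i).2 hlt) hi.not_gt⟩
  | @down x s s' h₀ h h₁ hx =>
    refine conn_of_free hx (slice_anti h) _ fun i hi hi' => ?_
    exact ⟨((lt_slice_iff hm s' i).1 hi').le,
      not_lt.1 fun hlt => absurd ((lt_slice_iff hm s i).2 hlt) hi.not_gt⟩
  | wrapUp hx =>
    simp only [orientedSlice, slice_zero hm, slice_top hm]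
    exact (Step.wrap _ _).conn.symm
  | wrapDown hx =>
    simp only [orientedSlice, slice_zero hm, slice_top hm]
    exact (Step.wrap _ _).conn
  | @crossUp x y s r s' hr h₀ h h' h₁ hx hy =>
    obtain ⟨j, he, rfl, hκ⟩ := hasTransition_ofSeq.1 hr
    exact (below _ h hx).symm.trans ((Step.cross _ he hκ).conn.trans (above _ h' hy).symm)
  | @crossDown x y s r s' hr h₀ h' h h₁ hx hy =>
    obtain ⟨j, he, rfl, hκ⟩ := hasTransition_ofSeq.1 hr
    exact (above _ h hx).trans
      ((Step.cross _ (he.trans Sym2.eq_swap) hκ).conn.symm.trans (below _ h' hy))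
  | @barUp x y s r s' hr hβ h₀ h h₀' h' hx hy =>
    obtain ⟨j, he, rfl, hκ⟩ := hasTransition_ofSeq.1 hr
    exact (below _ h hx).symm.trans ((Step.barBelow he hκ).conn.trans (below _ h' hy))
  | @barDown x y s r s' hr hβ h h₁ h' h₁' hx hy =>
    obtain ⟨j, he, rfl, hκ⟩ := hasTransition_ofSeq.1 hr
    exact (above _ h hx).trans ((Step.barAbove he hκ).conn.trans (above _ h' hy).symm)

lemma conn_of_sameTrajectory (hm : Backwards β m) {a b : OrientedPoint Λ}
    (h : SameTrajectory β (Config.ofSeq m) a b) :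
    Conn (edgesOf m) (kindsOf m) (orientedSlice m a) (orientedSlice m b) := by
  induction h with
  | rel a b h => exact conn_of_move hm h
  | refl a => exact .refl _
  | symm a b _ ih => exact ih.symm
  | trans a b c _ _ ih ih' => exact ih.trans ih'

/-- Every slice contains a time in `(0, β)` that is not the time of a transition. -/
lemma exists_mid (hβ : 0 < β) (hm : Backwards β m) (a : Fin (k + 1)) :
    ∃ s, 0 < s ∧ s < β ∧ slice m s = a ∧ ∀ i, (m i).2.1 ≠ s := by
  classical
  -- The transitions with index at least `a` are the earlier ones; together with 0 they lie strictly
  -- below the others together with β.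
  obtain ⟨s, h1, h2⟩ := Order.exists_between_finsets
    (insert 0 ((Finset.univ.filter fun i : Fin k => (a : ℕ) ≤ i).image fun i => (m i).2.1))
    (insert β ((Finset.univ.filter fun i : Fin k => (i : ℕ) < a).image fun i => (m i).2.1))
    (by
      simp only [Finset.mem_insert, Finset.mem_image, Finset.mem_filter, Finset.mem_univ,
        true_and]
      rintro _ (rfl | ⟨i, hi, rfl⟩) _ (rfl | ⟨j, hj, rfl⟩)
      · exact hβ
      · exact hm.pos j
      · exact hm.lt i
      · exact hm.anti (Fin.lt_def.2 (hj.trans_le hi)))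
  have hlo : ∀ i : Fin k, (a : ℕ) ≤ i → (m i).2.1 < s := fun i hi =>
    h1 _ (Finset.mem_insert_of_mem (Finset.mem_image_of_mem _ (by simpa using hi)))
  have hhi : ∀ i : Fin k, (i : ℕ) < a → s < (m i).2.1 := fun i hi =>
    h2 _ (Finset.mem_insert_of_mem (Finset.mem_image_of_mem _ (by simpa using hi)))
  refine ⟨s, h1 _ (Finset.mem_insert_self _ _), h2 _ (Finset.mem_insert_self _ _),
    (slice_eq_iff hm).2 fun i => ⟨hhi i, fun h => ?_⟩, fun i h => ?_⟩
  · by_contra hi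
    exact absurd h (hlo i (not_lt.1 hi)).not_gt
  · rcases lt_or_ge (i : ℕ) a with hi | hi
    · exact (hhi i hi).ne' h
    · exact (hlo i hi).ne h

/-- A time in the interior of a slice. -/
def mid (hβ : 0 < β) (hm : Backwards β m) (a : Fin (k + 1)) : ℝ := (exists_mid hβ hm a).choose

variable {hβ : 0 < β} {hm : Backwards β m}

lemma mid_pos (a : Fin (k + 1)) : 0 < mid hβ hm a := (exists_mid hβ hm a).choose_spec.1

lemma mid_lt (a : Fin (k + 1)) : mid hβ hm a < β := (exists_mid hβ hm a).choose_spec.2.1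

lemma slice_mid (a : Fin (k + 1)) : slice m (mid hβ hm a) = a :=
  (exists_mid hβ hm a).choose_spec.2.2.1

lemma time_ne_mid (a : Fin (k + 1)) (i : Fin k) : (m i).2.1 ≠ mid hβ hm a :=
  (exists_mid hβ hm a).choose_spec.2.2.2 i

lemma mid_lt_time_iff (a : Fin (k + 1)) (i : Fin k) :
    mid hβ hm a < (m i).2.1 ↔ (i : ℕ) < a := by
  rw [← lt_slice_iff hm, slice_mid]

lemma time_lt_mid_iff (a : Fin (k + 1)) (i : Fin k) :
    (m i).2.1 < mid hβ hm a ↔ (a : ℕ) ≤ i := by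
  rw [← not_lt, ← mid_lt_time_iff (hβ := hβ) (hm := hm), not_lt]
  exact ⟨le_of_lt, fun h => lt_of_le_of_ne h (time_ne_mid a i)⟩

/-- The point of an oriented slice at the chosen time. -/
def midPoint (hβ : 0 < β) (hm : Backwards β m) (a : (Λ × Fin (k + 1)) × Dir) :
    OrientedPoint Λ :=
  ⟨a.1.1, mid hβ hm a.1.2, a.2⟩

lemma SameTrajectory.symm {ω : Config (Transition G)} {a b : OrientedPoint Λ}
    (h : SameTrajectory β ω a b) : SameTrajectory β ω b a :=
  Relation.EqvGen.symm _ _ h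

lemma SameTrajectory.trans {ω : Config (Transition G)} {a b c : OrientedPoint Λ}
    (h : SameTrajectory β ω a b) (h' : SameTrajectory β ω b c) : SameTrajectory β ω a c :=
  Relation.EqvGen.trans _ _ _ h h'

lemma Move.same {ω : Config (Transition G)} {a b : OrientedPoint Λ} (h : Move β ω a b) :
    SameTrajectory β ω a b :=
  .rel _ _ h

/-- Free vertical motion in either direction. -/
lemma sameTrajectory_vertical {ω : Config (Transition G)} {x : Λ} {s s' : ℝ} (h₀ : 0 ≤ s)
    (h : s ≤ s') (h₁ : s' ≤ β) (hx : Free ω x (Icc s s')) (d : Dir) :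
    SameTrajectory β ω ⟨x, s, d⟩ ⟨x, s', d⟩ := by
  cases d with
  | up => exact (Move.up h₀ h h₁ hx).same
  | down => exact (Move.down h₀ h h₁ hx).same.symm

/-- The chosen times of adjacent slices have exactly one transition time between them, so each step
is realized by one move; `wrap` needs two vertical pieces and the identification of β with 0. -/
lemma sameTrajectory_of_step {a b : (Λ × Fin (k + 1)) × Dir}
    (h : Step (edgesOf m) (kindsOf m) a b) :
    SameTrajectory β (Config.ofSeq m) (midPoint hβ hm a) (midPoint hβ hm b) := by
  have hlo : ∀ j : Fin k, mid hβ hm j.succ < (m j).2.1 := fun j =>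
    (mid_lt_time_iff _ _).2 (by simp)
  have hhi : ∀ j : Fin k, (m j).2.1 < mid hβ hm j.castSucc := fun j =>
    (time_lt_mid_iff _ _).2 (by simp)
  have flo : ∀ (j : Fin k) (z : Λ),
      Free (Config.ofSeq m) z (Ico (mid hβ hm j.succ) (m j).2.1) := fun j z => by
    refine free_ofSeq.2 fun i _ hi => ?_
    have h1 : (i : ℕ) < j + 1 := (mid_lt_time_iff j.succ i).1 (lt_of_le_of_ne hi.1
      (time_ne_mid _ _).symm)
    have h2 : j < i := hm.anti.lt_iff_gt.1 hi.2
    have := Fin.lt_def.1 h2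
    omega
  have fhi : ∀ (j : Fin k) (z : Λ),
      Free (Config.ofSeq m) z (Ioc (m j).2.1 (mid hβ hm j.castSucc)) := fun j z => by
    refine free_ofSeq.2 fun i _ hi => ?_
    have h1 : (j : ℕ) ≤ i := (time_lt_mid_iff j.castSucc i).1 (lt_of_le_of_ne hi.2
      (time_ne_mid _ _))
    have h2 : i < j := hm.anti.lt_iff_gt.1 hi.1
    have := Fin.lt_def.1 h2
    omega
  have trans : ∀ {j : Fin k} {x y : Λ} {κ : Kind}, edgesOf m j = s(x, y) → kindsOf m j = κ →
      HasTransition (Config.ofSeq m) κ x y (m j).2.1 := fun {j _ _ _} he hκ =>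
    hasTransition_ofSeq.2 ⟨j, he, rfl, hκ⟩
  cases h with
  | @skip z i d h =>
    refine (sameTrajectory_vertical (mid_pos _).le ((hlo i).trans (hhi i)).le (mid_lt _).le
      (free_ofSeq.2 fun j hj hI => ?_) d).symm
    rcases lt_trichotomy (m j).2.1 (m i).2.1 with hlt | heq | hgt
    · exact free_ofSeq.1 (flo i z) j hj ⟨hI.1, hlt⟩
    · rw [hm.anti.injective heq] at hj
      exact h hj
    · exact free_ofSeq.1 (fhi i z) j hj ⟨hgt, hI.2⟩
  | @cross x y i d h hκ =>
    cases d with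
    | up =>
      exact (Move.crossUp (trans h hκ) (mid_pos _).le (hlo i) (hhi i) (mid_lt _).le
        (flo i x) (fhi i y)).same
    | down =>
      exact (Move.crossDown (trans (h.trans Sym2.eq_swap) hκ) (mid_pos _).le (hlo i) (hhi i)
        (mid_lt _).le (fhi i y) (flo i x)).same.symm
  | @barBelow x y i h hκ =>
    exact (Move.barUp (trans h hκ) (hm.lt i).le (mid_pos _).le (hlo i) (mid_pos _).le (hlo i)
      (flo i x) (flo i y)).same
  | @barAbove x y i h hκ =>
    exact (Move.barDown (trans h hκ) (hm.pos i).le (hhi i) (mid_lt _).le (hhi i) (mid_lt _).le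
      (fhi i x) (fhi i y)).same
  | wrap z d =>
    have h1 : SameTrajectory β (Config.ofSeq m) ⟨z, 0, d⟩ ⟨z, mid hβ hm (Fin.last k), d⟩ := by
      refine sameTrajectory_vertical le_rfl (mid_pos _).le (mid_lt _).le
        (free_ofSeq.2 fun j _ hI => ?_) d
      exact absurd ((mid_lt_time_iff (hβ := hβ) (hm := hm) (Fin.last k) j).2 j.2) hI.2.not_gt
    have h2 : SameTrajectory β (Config.ofSeq m) ⟨z, mid hβ hm 0, d⟩ ⟨z, β, d⟩ := by
      refine sameTrajectory_vertical (mid_pos _).le (mid_lt _).le le_rfl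
        (free_ofSeq.2 fun j _ hI => ?_) d
      exact absurd ((time_lt_mid_iff (hβ := hβ) (hm := hm) 0 j).2 (Nat.zero_le _)) hI.1.not_gt
    have hf : Free (Config.ofSeq m) z {0, β} := free_ofSeq.2 fun j _ hI => by
      rcases hI with h | h
      · exact (hm.pos j).ne' h
      · exact (hm.lt j).ne h
    have h3 : SameTrajectory β (Config.ofSeq m) ⟨z, β, d⟩ ⟨z, 0, d⟩ := by
      cases d with
      | up => exact (Move.wrapUp hf).same
      | down => exact (Move.wrapDown hf).same.symm
    exact (h2.trans (h3.trans h1)).symm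

lemma sameTrajectory_of_conn {a b : (Λ × Fin (k + 1)) × Dir}
    (h : Conn (edgesOf m) (kindsOf m) a b) :
    SameTrajectory β (Config.ofSeq m) (midPoint hβ hm a) (midPoint hβ hm b) := by
  induction h with
  | rel a b h => exact sameTrajectory_of_step h
  | refl a => exact .refl _
  | symm a b _ ih => exact ih.symm
  | trans a b c _ _ ih ih' => exact ih.trans ih'

lemma sameTrajectory_midPoint {x : Λ} {s : ℝ}
    (hp : (x, s) ∈ regularPoints β (Config.ofSeq m)) (d : Dir) :
    SameTrajectory β (Config.ofSeq m) ⟨x, s, d⟩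
      (midPoint hβ hm (orientedSlice m ⟨x, s, d⟩)) := by
  obtain ⟨⟨h0, h1⟩, hf⟩ := hp
  -- Regularity excludes only transitions touching `x`; `s` may still be the time of a transition
  -- elsewhere.
  have hreg : ∀ j, x ∈ edgesOf m j → (m j).2.1 ≠ s := fun j hj h => free_ofSeq.1 hf j hj h
  have hcmp : ∀ j, s < (m j).2.1 ↔ mid hβ hm (slice m s) < (m j).2.1 := fun j => by
    rw [mid_lt_time_iff, lt_slice_iff hm]
  rcases le_total s (mid hβ hm (slice m s)) with h | h
  · refine sameTrajectory_vertical h0 h (mid_lt _).le (free_ofSeq.2 fun j hj hI => ?_) d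
    exact absurd ((hcmp j).1 (lt_of_le_of_ne hI.1 (hreg j hj).symm)) hI.2.not_gt
  · refine (sameTrajectory_vertical (mid_pos _).le h h1 (free_ofSeq.2 fun j hj hI => ?_) d).symm
    exact absurd ((hcmp j).2 (lt_of_le_of_ne hI.1 (time_ne_mid _ _).symm)) hI.2.not_gt

/-- On regular points, trajectories are described by the discrete trajectories of slices. -/
lemma sameTrajectory_iff (hβ : 0 < β) (hm : Backwards β m) {p q : Λ × ℝ}
    (hp : p ∈ regularPoints β (Config.ofSeq m)) (hq : q ∈ regularPoints β (Config.ofSeq m))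
    (d d' : Dir) :
    SameTrajectory β (Config.ofSeq m) ⟨p.1, p.2, d⟩ ⟨q.1, q.2, d'⟩ ↔
      Conn (edgesOf m) (kindsOf m) ((p.1, slice m p.2), d) ((q.1, slice m q.2), d') := by
  refine ⟨conn_of_sameTrajectory hm, fun h => ?_⟩
  exact (sameTrajectory_midPoint (hβ := hβ) (hm := hm) hp d).trans
    ((sameTrajectory_of_conn h).trans (sameTrajectory_midPoint hq d').symm)

/-- The number of loops of a configuration is the number of discrete loops. -/
lemma ncard_loops (hβ : 0 < β) (hm : Backwards β m) :
    (loops β (Config.ofSeq m)).ncard = Nat.card (LoopQuot (edgesOf m) (kindsOf m)) := by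
  set π : Λ × ℝ → LoopQuot (edgesOf m) (kindsOf m) := fun p => Quotient.mk _ (p.1, slice m p.2)
    with hπ
  have hthrough : ∀ p ∈ regularPoints β (Config.ofSeq m), loopThrough β (Config.ofSeq m) p =
      {q | q ∈ regularPoints β (Config.ofSeq m) ∧ π p = π q} := fun p hp => by
    ext q
    refine and_congr_right fun hq => ?_
    rw [hπ, loopQuot_eq_iff]
    exact exists_congr fun d => sameTrajectory_iff hβ hm hp hq _ _
  -- Loops are the fibers of π on regular points; every discrete loop has one, since the chosen
  -- times of slices avoid all transitions.
  have hsurj : ∀ c, ∃ p ∈ regularPoints β (Config.ofSeq m), π p = c := fun c => by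
    induction c using Quotient.ind with
    | _ a =>
      refine ⟨(a.1, mid hβ hm a.2), ⟨⟨(mid_pos (hβ := hβ) (hm := hm) _).le,
        (mid_lt (hβ := hβ) (hm := hm) _).le⟩,
        free_ofSeq.2 fun j _ h => time_ne_mid (hβ := hβ) (hm := hm) _ _ h⟩, ?_⟩
      simp only [hπ, slice_mid]
  have himg : loops β (Config.ofSeq m) = Set.range
      fun c => {q | q ∈ regularPoints β (Config.ofSeq m) ∧ c = π q} := by
    ext L
    constructor
    · rintro ⟨p, hp, rfl⟩
      exact ⟨π p, (hthrough p hp).symm⟩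
    · rintro ⟨c, rfl⟩
      obtain ⟨p, hp, rfl⟩ := hsurj c
      exact ⟨p, hp, hthrough p hp⟩
  rw [himg, ← Set.image_univ, Set.ncard_image_of_injective, Set.ncard_univ]
  intro c c' h
  obtain ⟨p, hp, rfl⟩ := hsurj c
  have : p ∈ {q | q ∈ regularPoints β (Config.ofSeq m) ∧ c' = π q} :=
    (Set.ext_iff.1 h p).1 ⟨hp, rfl⟩
  exact this.2.symm

/-- Time 0 lies in the last slice, which `wrap` identifies with slice 0, where the first operator of
the trace is read. -/
lemma conn_zero_iff (hm : Backwards β m) {x : Λ} {b : (Λ × Fin (k + 1)) × Dir} {d : Dir} :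
    Conn (edgesOf m) (kindsOf m) ((x, slice m 0), d) b ↔
      Conn (edgesOf m) (kindsOf m) ((x, 0), d) b := by
  rw [slice_zero hm]
  exact ⟨(Step.wrap _ _).conn.symm.trans, (Step.wrap _ _).conn.trans⟩

lemma sameTrajectory_zero_iff (hβ : 0 < β) (hm : Backwards β m) {x y : Λ} {t : ℝ}
    (ht : t ∈ Icc 0 β) (hne : ∀ i, (m i).2.1 ≠ t) (d : Dir) :
    SameTrajectory β (Config.ofSeq m) ⟨x, 0, .up⟩ ⟨y, t, d⟩ ↔
      Conn (edgesOf m) (kindsOf m) ((x, 0), .up) ((y, slice m t), d) := by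
  rw [← conn_zero_iff hm]
  exact sameTrajectory_iff (p := (x, 0)) (q := (y, t)) hβ hm
    ⟨⟨le_rfl, hβ.le⟩, free_ofSeq.2 fun j _ h => (hm.pos j).ne' h⟩
    ⟨ht, free_ofSeq.2 fun j _ h => hne j h⟩ _ _

end Trajectories


/-! ### Measurability and almost sure properties of configurations -/

section Measurability

variable {Λ : Type*} [Finite Λ] {G : SimpleGraph Λ}

instance : DiscreteMeasurableSpace Kind := ⟨fun _ => trivial⟩

omit [Finite Λ] in
instance : DiscreteMeasurableSpace G.edgeSet := ⟨fun _ => trivial⟩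

instance : Fintype Kind :=
  ⟨⟨([Kind.cross, Kind.bar] : List Kind), by simp⟩, by rintro (_ | _) <;> simp⟩

instance : Finite G.edgeSet := inferInstance

lemma measurableSet_config_iff {X : Type*} [MeasurableSpace X] {S : Set (Config X)} :
    MeasurableSet S ↔ ∀ k : ℕ, MeasurableSet ((fun p : Fin k → X => Config.ofSeq p) ⁻¹' S) :=
  MeasurableSpace.measurableSet_iInf

lemma measurable_ofSeq {X : Type*} [MeasurableSpace X] (k : ℕ) :
    Measurable fun p : Fin k → X => Config.ofSeq p :=
  fun _ hS => measurableSet_config_iff.1 hS k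

lemma config_ext {X : Type*} {ω ω' : Config X} (h : ∀ a, a ∈ ω ↔ a ∈ ω') : ω = ω' :=
  Finset.ext h

/-- The configurations with distinct transition times in `(0, β)` other than `t`. -/
def niceConfigs (G : SimpleGraph Λ) (β t : ℝ) : Set (Config (Transition G)) :=
  {ω | ∃ (k : ℕ) (m : Fin k → Transition G),
    Backwards β m ∧ (∀ i, (m i).2.1 ≠ t) ∧ Config.ofSeq m = ω}

/-- The discrete data of a sequence of transitions: the marks and the relative positions of the
times. -/
def cell (G : SimpleGraph Λ) (β t : ℝ) (k : ℕ) (p : Fin k → Transition G) :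
    (Fin k → G.edgeSet) × (Fin k → Kind) × (Fin k → Fin k → Prop) × (Fin k → Prop) ×
      (Fin k → Prop) × (Fin k → Prop) × (Fin k → Prop) :=
  (fun i => (p i).1, fun i => (p i).2.2, fun i j => (p i).2.1 < (p j).2.1,
    fun i => 0 < (p i).2.1, fun i => (p i).2.1 < β, fun i => (p i).2.1 < t,
    fun i => t < (p i).2.1)

omit [Finite Λ] in
lemma measurable_cell (G : SimpleGraph Λ) (β t : ℝ) (k : ℕ) : Measurable (cell G β t k) := by
  have ht : ∀ i : Fin k, Measurable fun p : Fin k → Transition G => (p i).2.1 := fun i => by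
    fun_prop
  refine Measurable.prodMk (by fun_prop) (Measurable.prodMk (by fun_prop)
    (Measurable.prodMk ?_ (Measurable.prodMk ?_ (Measurable.prodMk ?_ (Measurable.prodMk ?_ ?_)))))
  · exact measurable_pi_iff.2 fun i => measurable_pi_iff.2 fun j =>
      measurableSet_setOfPred.1 (measurableSet_lt (ht i) (ht j))
  · exact measurable_pi_iff.2 fun i =>
      measurableSet_setOfPred.1 (measurableSet_lt measurable_const (ht i))
  · exact measurable_pi_iff.2 fun i =>
      measurableSet_setOfPred.1 (measurableSet_lt (ht i) measurable_const)
  · exact measurable_pi_iff.2 fun i =>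
      measurableSet_setOfPred.1 (measurableSet_lt (ht i) measurable_const)
  · exact measurable_pi_iff.2 fun i =>
      measurableSet_setOfPred.1 (measurableSet_lt measurable_const (ht i))

/-- Sets of configurations that depend only on the order and the marks of the transitions are
measurable, up to exceptional configurations. -/
lemma measurableSet_nice_inter (β t : ℝ) {S : Set (Config (Transition G))}
    (hS : ∀ (k : ℕ) (m m' : Fin k → Transition G), Backwards β m → Backwards β m' →
      (∀ i, (m i).2.1 ≠ t) → (∀ i, (m' i).2.1 ≠ t) → edgesOf m = edgesOf m' →
      kindsOf m = kindsOf m' → slice m t = slice m' t →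
      Config.ofSeq m ∈ S → Config.ofSeq m' ∈ S) :
    MeasurableSet (niceConfigs G β t ∩ S) := by
  refine measurableSet_config_iff.2 fun N => ?_
  set P := (fun p : Fin N → Transition G => Config.ofSeq p) ⁻¹' (niceConfigs G β t ∩ S) with hP
  -- Membership depends only on the cell, which takes finitely many values. As `p` may be unordered
  -- and have repetitions, a backwards enumeration of its points is chosen through indices `h`, and
  -- the same indices serve for `p'`.
  have key : ∀ p ∈ P, ∀ p', cell G β t N p = cell G β t N p' → p' ∈ P := by
    rintro p ⟨⟨k, m, hm, hmt, hmp⟩, hpS⟩ p' hc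
    simp only [cell, Prod.mk.injEq, funext_iff, eq_iff_iff] at hc
    obtain ⟨c1, c2, c3, c4, c5, c6, c7⟩ := hc
    have hex : ∀ i, ∃ j, p j = m i := fun i => by
      have : m i ∈ Config.ofSeq p := by
        change Config.ofSeq m = Config.ofSeq p at hmp
        rw [← hmp]
        exact mem_ofSeq.2 ⟨i, rfl⟩
      exact mem_ofSeq.1 this
    choose h hh using hex
    have hm' : Backwards β fun i => p' (h i) := by
      refine ⟨fun i j hij => ?_, fun i => ?_, fun i => ?_⟩
      · have := hm.anti hij
        simp only [← hh] at this
        exact (c3 _ _).1 this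
      · have := hm.pos i
        rw [← hh] at this
        exact (c4 _).1 this
      · have := hm.lt i
        rw [← hh] at this
        exact (c5 _).1 this
    have hmt' : ∀ i, (p' (h i)).2.1 ≠ t := fun i => by
      have := hmt i
      rw [← hh] at this
      rcases lt_or_gt_of_ne this with h' | h'
      · exact ((c6 _).1 h').ne
      · exact ((c7 _).1 h').ne'
    have hof : Config.ofSeq (fun i => p' (h i)) = Config.ofSeq p' := by
      refine config_ext fun a => ?_
      rw [mem_ofSeq, mem_ofSeq]
      constructor
      · rintro ⟨i, rfl⟩
        exact ⟨_, rfl⟩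
      · rintro ⟨i, rfl⟩
        have h1 : p i ∈ Config.ofSeq m := by
          change Config.ofSeq m = Config.ofSeq p at hmp
          rw [hmp]
          exact mem_ofSeq.2 ⟨i, rfl⟩
        obtain ⟨l, hl⟩ := mem_ofSeq.1 h1
        have h2 : p (h l) = p i := (hh l).trans hl
        refine ⟨l, Prod.ext ?_ (Prod.ext ?_ ?_)⟩
        · rw [← c1, ← c1, h2]
        · refine le_antisymm (not_lt.1 fun hlt => ?_) (not_lt.1 fun hlt => ?_)
          · have := (c3 _ _).2 hlt
            rw [h2] at this
            exact lt_irrefl _ this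
          · have := (c3 _ _).2 hlt
            rw [h2] at this
            exact lt_irrefl _ this
        · rw [← c2, ← c2, h2]
    refine ⟨⟨k, _, hm', hmt', hof⟩, ?_⟩
    change Config.ofSeq p' ∈ S
    rw [← hof]
    refine hS k m _ hm hm' hmt hmt' (funext fun i => ?_) (funext fun i => ?_) ?_ ?_
    · simp only [edgesOf, ← hh, c1]
    · simp only [kindsOf, ← hh, c2]
    · simp only [slice, ← hh, c7]
    · change Config.ofSeq m = Config.ofSeq p at hmp
      rw [hmp]
      exact hpS
  have hPe : P = cell G β t N ⁻¹' (cell G β t N '' P) := by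
    ext p'
    constructor
    · intro h
      exact ⟨p', h, rfl⟩
    · rintro ⟨p, hp, hc⟩
      exact key p hp p' hc
  rw [hPe]
  exact measurable_cell G β t N (Set.toFinite _).measurableSet

lemma measurableSet_niceConfigs (β t : ℝ) : MeasurableSet (niceConfigs G β t) := by
  have := measurableSet_nice_inter (G := G) β t (S := univ) (fun _ _ _ _ _ _ _ _ _ _ _ => trivial)
  rwa [inter_univ] at this

/-! ### Marks and times -/

/-- The sequence of transitions with given marks and times. -/
def withTimes {k : ℕ} (z : (Fin k → G.edgeSet × Kind) × (Fin k → ℝ)) (i : Fin k) :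
    Transition G :=
  ((z.1 i).1, z.2 i, (z.1 i).2)

/-- The intensity measure of the marks. -/
def markMeasure (G : SimpleGraph Λ) (u : ℝ) : Measure (G.edgeSet × Kind) :=
  (Measure.count : Measure G.edgeSet).prod
    (ENNReal.ofReal u • Measure.dirac Kind.cross + ENNReal.ofReal (1 - u) • Measure.dirac Kind.bar)

instance isFiniteMeasure_kinds (u : ℝ) : IsFiniteMeasure
    (ENNReal.ofReal u • Measure.dirac Kind.cross +
      ENNReal.ofReal (1 - u) • Measure.dirac Kind.bar) := by
  refine ⟨?_⟩
  simp

instance (u : ℝ) : IsFiniteMeasure (markMeasure G u) := by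
  unfold markMeasure
  infer_instance

instance (β u : ℝ) : IsFiniteMeasure (intensity G β u) := by
  unfold intensity
  infer_instance

/-- Separating marks from times allows the marks to be summed, for fixed times, before the times are
integrated. -/
lemma measurePreserving_withTimes (β u : ℝ) (k : ℕ) :
    MeasurePreserving (withTimes (G := G) (k := k))
      ((Measure.pi fun _ => markMeasure G u).prod
        (Measure.pi fun _ => volume.restrict (Icc 0 β)))
      (Measure.pi fun _ => intensity G β u) := by
  have h1 := (measurePreserving_arrowProdEquivProdArrow (G.edgeSet × Kind) ℝ (Fin k)
    (fun _ => markMeasure G u) (fun _ => volume.restrict (Icc 0 β))).symm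
  have h2 : MeasurePreserving (fun a : (G.edgeSet × Kind) × ℝ => (a.1.1, a.2, a.1.2))
      ((markMeasure G u).prod (volume.restrict (Icc 0 β))) (intensity G β u) := by
    have h3 := measurePreserving_prodAssoc (Measure.count : Measure G.edgeSet)
      (ENNReal.ofReal u • Measure.dirac Kind.cross +
        ENNReal.ofReal (1 - u) • Measure.dirac Kind.bar) (volume.restrict (Icc (0 : ℝ) β))
    have h4 := (MeasurePreserving.id (Measure.count : Measure G.edgeSet)).prod
      (Measure.measurePreserving_swap (μ := (ENNReal.ofReal u • Measure.dirac Kind.cross +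
        ENNReal.ofReal (1 - u) • Measure.dirac Kind.bar)) (ν := volume.restrict (Icc (0 : ℝ) β)))
    exact h4.comp h3
  have h5 := measurePreserving_pi (fun _ : Fin k => (markMeasure G u).prod
    (volume.restrict (Icc (0 : ℝ) β))) (fun _ : Fin k => intensity G β u) (fun _ => h2)
  exact h5.comp h1

/-- Distinct times in `(0, β)`, all different from `t`. -/
structure GoodTimes (β t : ℝ) {k : ℕ} (s : Fin k → ℝ) : Prop where
  inj : Function.Injective s
  pos : ∀ i, 0 < s i
  lt : ∀ i, s i < β
  ne : ∀ i, s i ≠ t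

lemma ae_goodTimes (β t : ℝ) (k : ℕ) :
    ∀ᵐ s ∂(Measure.pi fun _ : Fin k => volume.restrict (Icc 0 β)), GoodTimes β t s := by
  have hne : ∀ (i : Fin k) (c : ℝ),
      ∀ᵐ s ∂(Measure.pi fun _ : Fin k => volume.restrict (Icc 0 β)), s i ≠ c := fun i c =>
    Measure.ae_eval_ne (μ := fun _ : Fin k => volume.restrict (Icc (0 : ℝ) β)) i c
  have hmem : ∀ᵐ s ∂(Measure.pi fun _ : Fin k => volume.restrict (Icc 0 β)),
      ∀ i, s i ∈ Icc 0 β := by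
    rw [← Measure.restrict_pi_pi]
    filter_upwards [ae_restrict_mem (MeasurableSet.univ_pi fun _ => measurableSet_Icc)] with s hs i
    exact hs i trivial
  have hinj : ∀ i j : Fin k, i ≠ j →
      ∀ᵐ s ∂(Measure.pi fun _ : Fin k => volume.restrict (Icc 0 β)), s i ≠ s j := by
    intro i j hij
    rw [← Measure.restrict_pi_pi]
    refine ae_restrict_of_ae ?_
    -- Coincidence of two times is a proper linear subspace, hence Lebesgue-null.
    have h1 := Measure.addHaar_submodule (volume : Measure (Fin k → ℝ))
      (LinearMap.ker (LinearMap.proj (R := ℝ) (φ := fun _ : Fin k => ℝ) i - LinearMap.proj j)) (by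
        intro h
        have h2 : Pi.single i (1 : ℝ) ∈ LinearMap.ker
            (LinearMap.proj (R := ℝ) (φ := fun _ : Fin k => ℝ) i - LinearMap.proj j) := by
          rw [h]
          trivial
        simp [hij.symm] at h2)
    rw [ae_iff]
    refine measure_mono_null (fun s hs => ?_) h1
    simpa [sub_eq_zero] using hs
  have hinj' : ∀ᵐ s ∂(Measure.pi fun _ : Fin k => volume.restrict (Icc 0 β)),
      ∀ i j : Fin k, i ≠ j → s i ≠ s j := by
    rw [ae_all_iff]
    intro i
    rw [ae_all_iff]
    intro j
    by_cases hij : i = j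
    · exact Filter.Eventually.of_forall fun _ h => absurd hij h
    · filter_upwards [hinj i j hij] with s hs _ using hs
  filter_upwards [hmem, hinj', ae_all_iff.2 fun i => hne i 0, ae_all_iff.2 fun i => hne i β,
    ae_all_iff.2 fun i => hne i t] with s h1 h2 h3 h4 h5
  exact ⟨fun i j hij => by_contra fun h => h2 i j h hij,
    fun i => lt_of_le_of_ne (h1 i).1 (h3 i).symm, fun i => lt_of_le_of_ne (h1 i).2 (h4 i), h5⟩

omit [Finite Λ] in
/-- Sorting good times. -/
lemma GoodTimes.exists_sort {β t : ℝ} {k : ℕ} {s : Fin k → ℝ} (hs : GoodTimes β t s) :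
    ∃ π : Equiv.Perm (Fin k), ∀ f : Fin k → G.edgeSet × Kind,
      Backwards β (withTimes (f ∘ π, s ∘ π)) ∧
      Config.ofSeq (withTimes (f ∘ π, s ∘ π)) = Config.ofSeq (withTimes (f, s)) := by
  -- The permutation depends on the times only, so a sum over the marks can be reindexed by it.
  refine ⟨Tuple.sort fun i => - s i, fun f => ⟨⟨?_, fun i => hs.pos _, fun i => hs.lt _⟩, ?_⟩⟩
  · have h1 := Tuple.monotone_sort fun i => - s i
    have h2 : Antitone (s ∘ Tuple.sort fun i => - s i) := fun i j hij => neg_le_neg_iff.1 (h1 hij)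
    exact h2.strictAnti_of_injective (hs.inj.comp (Equiv.injective _))
  · refine config_ext fun a => ?_
    rw [mem_ofSeq, mem_ofSeq]
    exact ((Tuple.sort fun i => - s i).surjective.exists (p := fun i =>
      withTimes (f, s) i = a)).symm

lemma ae_withTimes {β u : ℝ} {k : ℕ} {P : (Fin k → Transition G) → Prop}
    (hP : MeasurableSet {p | P p})
    (h : ∀ᵐ s ∂(Measure.pi fun _ : Fin k => volume.restrict (Icc 0 β)),
      ∀ f, P (withTimes (f, s))) :
    ∀ᵐ p ∂(Measure.pi fun _ : Fin k => intensity G β u), P p := by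
  have hmp := measurePreserving_withTimes (G := G) β u k
  rw [← hmp.map_eq, ae_map_iff hmp.measurable.aemeasurable hP]
  have := Measure.quasiMeasurePreserving_snd
    (μ := Measure.pi fun _ : Fin k => markMeasure G u)
    (ν := Measure.pi fun _ : Fin k => volume.restrict (Icc 0 β)) |>.ae h
  filter_upwards [this] with z hz using hz z.1

lemma ae_nice_ofSeq (β u t : ℝ) (k : ℕ) :
    ∀ᵐ p ∂(Measure.pi fun _ : Fin k => intensity G β u),
      Config.ofSeq p ∈ niceConfigs G β t := by
  refine ae_withTimes (measurable_ofSeq k (measurableSet_niceConfigs β t)) ?_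
  filter_upwards [ae_goodTimes β t k] with s hs f
  obtain ⟨π, hπ⟩ := hs.exists_sort (G := G)
  exact ⟨k, _, (hπ f).1, fun i => hs.ne _, (hπ f).2⟩

lemma ae_nice (β u t : ℝ) : ∀ᵐ ω ∂(rho G β u), ω ∈ niceConfigs G β t := by
  have hmeas := measurableSet_niceConfigs (G := G) β t
  rw [rho, poissonProcess]
  refine (Measure.ae_sum_iff' hmeas).2 ?_
  intro k
  refine Measure.ae_smul_measure ?_ _
  exact (ae_map_iff (measurable_ofSeq k).aemeasurable hmeas).2 (ae_nice_ofSeq β u t k)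

end Measurability


/-! ### Poisson expansion of Schwinger functions -/

section Expansion

variable {Λ : Type*} [Fintype Λ] [DecidableEq Λ] {G : SimpleGraph Λ} {n : ℕ}

/-- The intensity of the events of a given kind. -/
def kindWeight (u : ℝ) : Kind → ℝ
  | .cross => u
  | .bar => 1 - u

lemma markMeasure_real_singleton {u : ℝ} (hu : u ∈ Icc (0 : ℝ) 1) (a : G.edgeSet × Kind) :
    (markMeasure G u).real {a} = kindWeight u a.2 := by
  obtain ⟨e, κ⟩ := a
  rw [← singleton_prod_singleton, markMeasure, measureReal_def, Measure.prod_prod,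
    Measure.count_singleton, one_mul]
  cases κ <;> simp [kindWeight, hu.1, hu.2]

/-- The sum of the transition operators with their intensities. -/
def transSum (G : SimpleGraph Λ) [DecidableRel G.Adj] (n : ℕ) (u : ℝ) : Op Λ n :=
  ∑ a : G.edgeSet × Kind, (kindWeight u a.2 : ℂ) • transMat id (a.1 : Sym2 Λ) a.2

variable [DecidableRel G.Adj]

/-- The number of times after `t`. -/
def lateCount (t : ℝ) {k : ℕ} (s : Fin k → ℝ) : ℕ :=
  (Finset.univ.filter fun i => t < s i).card

lemma lateCount_le (t : ℝ) {k : ℕ} (s : Fin k → ℝ) : lateCount t s ≤ k :=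
  (Finset.card_le_univ _).trans_eq (Fintype.card_fin k)

lemma lateCount_comp_perm (t : ℝ) {k : ℕ} (s : Fin k → ℝ) (π : Equiv.Perm (Fin k)) :
    lateCount t (s ∘ π) = lateCount t s := by
  refine Finset.card_bij (fun i _ => π i) (fun i hi => by simpa using hi)
    (fun i _ j _ h => π.injective h) fun j hj => ⟨π.symm j, by simpa using hj, by simp⟩

/-- `F` is given by traces of time-ordered products of transition operators, with insertions of
`A` at time `0` and of `B` at time `t`. -/
def IsTraceFunction (β t : ℝ) (A B : Op Λ n) (F : Config (Transition G) → ℂ) : Prop :=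
  ∀ (k : ℕ) (m : Fin k → Transition G), Backwards β m → (∀ i, (m i).2.1 ≠ t) →
    F (Config.ofSeq m) = (A * insertProd B (slice m t)
      (List.ofFn fun i => transMat id (edgesOf m i) (kindsOf m i))).trace

variable {β t u : ℝ} {A B : Op Λ n} {F : Config (Transition G) → ℂ}

/-- The marks are reindexed by the sorting permutation, which leaves the product of weights
unchanged; the sum of all ordered products is then the expansion of powers of K around `B`. -/
lemma sum_marks (hF : IsTraceFunction β t A B F) {k : ℕ} {s : Fin k → ℝ}
    (hs : GoodTimes β t s) :
    ∑ f : Fin k → G.edgeSet × Kind, (∏ i, (kindWeight u (f i).2 : ℂ)) *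
        F (Config.ofSeq (withTimes (f, s))) =
      (A * (transSum G n u ^ lateCount t s * B * transSum G n u ^ (k - lateCount t s))).trace := by
  obtain ⟨π, hπ⟩ := hs.exists_sort (G := G)
  have h1 : ∀ f : Fin k → G.edgeSet × Kind, F (Config.ofSeq (withTimes (f, s))) =
      (A * insertProd B (lateCount t s)
        (List.ofFn fun i => transMat id ((f (π i)).1 : Sym2 Λ) (f (π i)).2)).trace := fun f => by
    rw [← (hπ f).2, hF k _ (hπ f).1 fun i => hs.ne _, ← lateCount_comp_perm t s π]
    rfl
  rw [transSum, ← sum_insertProd_ofFn B _ k _ (lateCount_le t s), Finset.mul_sum,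
    Matrix.trace_sum]
  refine Fintype.sum_equiv (Equiv.arrowCongr π.symm (Equiv.refl _)) _ _ fun f => ?_
  rw [h1, insertProd_ofFn_smul, mul_smul_comm, Matrix.trace_smul, smul_eq_mul]
  simp only [Equiv.arrowCongr_apply, Equiv.symm_symm, Equiv.coe_refl, Function.comp_apply, id]
  rw [Equiv.prod_comp π fun i => (kindWeight u (f i).2 : ℂ)]

/-- The cube is partitioned by the set S of indices of times after t; each piece is a box of volume
(β − t)^|S| t^(k − |S|). -/
lemma integral_lateCount (ht : t ∈ Icc 0 β) (k : ℕ) (g : ℕ → ℂ) :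
    ∫ s, g (lateCount t s) ∂(Measure.pi fun _ : Fin k => volume.restrict (Icc 0 β)) =
      ∑ j ∈ Finset.range (k + 1), (k.choose j : ℂ) *
        (((β - t : ℝ) : ℂ) ^ j * (t : ℂ) ^ (k - j) * g j) := by
  set μ : Measure (Fin k → ℝ) := Measure.pi fun _ => volume.restrict (Icc 0 β)
  set E : Finset (Fin k) → Set (Fin k → ℝ) :=
    fun S => univ.pi fun i => if i ∈ S then Ioi t else Iic t with hE
  have hEm : ∀ S, MeasurableSet (E S) := fun S => MeasurableSet.univ_pi fun i => by
    split_ifs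
    · exact measurableSet_Ioi
    · exact measurableSet_Iic
  have hmem : ∀ S s, s ∈ E S ↔ (Finset.univ.filter fun i => t < s i) = S := fun S s => by
    simp only [hE, Set.mem_univ_pi, Finset.ext_iff, Finset.mem_filter, Finset.mem_univ, true_and]
    refine forall_congr' fun i => ?_
    split_ifs with h <;> simp [h]
  have hμ : ∀ S, μ.real (E S) = (β - t) ^ S.card * t ^ (k - S.card) := fun S => by
    rw [measureReal_def, Measure.pi_pi, ENNReal.toReal_prod]
    have h1 : ∀ i, ((volume.restrict (Icc (0 : ℝ) β)) (if i ∈ S then Ioi t else Iic t)).toReal =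
        if i ∈ S then β - t else t := fun i => by
      split_ifs
      · rw [Measure.restrict_apply measurableSet_Ioi,
          show Ioi t ∩ Icc 0 β = Ioc t β by
            ext r
            exact ⟨fun h => ⟨h.1, h.2.2⟩, fun h => ⟨h.1, ht.1.trans h.1.le, h.2⟩⟩,
          Real.volume_Ioc, ENNReal.toReal_ofReal (sub_nonneg.2 ht.2)]
      · rw [Measure.restrict_apply measurableSet_Iic,
          show Iic t ∩ Icc 0 β = Icc 0 t by
            ext r
            exact ⟨fun h => ⟨h.2.1, h.1⟩, fun h => ⟨h.2, h.1, le_trans h.2 ht.2⟩⟩,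
          Real.volume_Icc, sub_zero, ENNReal.toReal_ofReal ht.1]
    simp only [h1, Finset.prod_ite, Finset.prod_const]
    congr 2
    · simp
    · rw [Finset.filter_not, Finset.card_sdiff]
      simp
  have hsum : ∀ s, g (lateCount t s) =
      ∑ S : Finset (Fin k), (E S).indicator (fun _ => g S.card) s := fun s => by
    rw [Finset.sum_eq_single (Finset.univ.filter fun i => t < s i),
      indicator_of_mem ((hmem _ _).2 rfl)]
    · rfl
    · intro S _ hS
      exact indicator_of_notMem (fun h => hS ((hmem _ _).1 h).symm) _
    · simp
  simp only [hsum]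
  rw [integral_finsetSum _ fun S _ => (integrable_const _).indicator (hEm S)]
  simp only [integral_indicator_const _ (hEm _), hμ]
  have h2 := Finset.sum_powerset_apply_card (x := (Finset.univ : Finset (Fin k)))
    fun j => (((β - t) ^ j * t ^ (k - j) : ℝ)) • g j
  rw [Finset.powerset_univ, Finset.card_univ, Fintype.card_fin] at h2
  rw [h2]
  refine Finset.sum_congr rfl fun j _ => ?_
  rw [nsmul_eq_mul, Complex.real_smul]
  push_cast
  ring

lemma integral_ofSeq (hu : u ∈ Icc (0 : ℝ) 1) (ht : t ∈ Icc 0 β)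
    (hF : IsTraceFunction β t A B F) (k : ℕ)
    (hint : Integrable (fun p : Fin k → Transition G => F (Config.ofSeq p))
      (Measure.pi fun _ => intensity G β u)) :
    ∫ p, F (Config.ofSeq p) ∂(Measure.pi fun _ : Fin k => intensity G β u) =
      ∑ j ∈ Finset.range (k + 1), (k.choose j : ℂ) *
        (((β - t : ℝ) : ℂ) ^ j * (t : ℂ) ^ (k - j) *
          (A * (transSum G n u ^ j * B * transSum G n u ^ (k - j))).trace) := by
  have hmp := measurePreserving_withTimes (G := G) β u k
  rw [← hmp.map_eq] at hint ⊢
  have hint' : Integrable (fun z => F (Config.ofSeq (withTimes z)))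
      ((Measure.pi fun _ : Fin k => markMeasure G u).prod
        (Measure.pi fun _ => volume.restrict (Icc 0 β))) :=
    hint.comp_measurable hmp.measurable
  rw [integral_map hmp.measurable.aemeasurable hint.aestronglyMeasurable,
    integral_prod_symm _ hint',
    ← integral_lateCount ht k fun j =>
      (A * (transSum G n u ^ j * B * transSum G n u ^ (k - j))).trace]
  refine integral_congr_ae ?_
  filter_upwards [ae_goodTimes β t k] with s hs
  rw [← sum_marks (u := u) hF hs, integral_fintype .of_finite]
  refine Finset.sum_congr rfl fun f _ => ?_
  rw [measureReal_def, Measure.pi_singleton, ENNReal.toReal_prod]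
  simp only [← measureReal_def, markMeasure_real_singleton hu]
  rw [Complex.real_smul]
  push_cast
  rfl

/-- The weights of the two kinds add up to 1. The resulting factor exp(−β|E|) of the Poisson law is
the scalar part of exp(−βH). -/
lemma intensity_univ (hu : u ∈ Icc (0 : ℝ) 1) (hβ : 0 ≤ β) :
    (intensity G β u univ).toReal = β * G.edgeFinset.card := by
  rw [intensity, ← univ_prod_univ, Measure.prod_prod, ← univ_prod_univ, Measure.prod_prod]
  have h1 : (ENNReal.ofReal u • Measure.dirac Kind.cross +
      ENNReal.ofReal (1 - u) • Measure.dirac Kind.bar) univ = 1 := by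
    simp [← ENNReal.ofReal_add hu.1 (sub_nonneg.2 hu.2)]
  have h2 : (Measure.count (univ : Set G.edgeSet)).toReal = G.edgeFinset.card := by
    rw [Measure.count_apply MeasurableSet.univ]
    simp [SimpleGraph.edgeFinset, Set.encard_univ]
  rw [h1, mul_one, ENNReal.toReal_mul, h2]
  simp [hβ, mul_comm]

end Expansion


/-! ### Exponential series with inserted factors -/

section Exponentials

/-- The Cauchy product of two exponential series with two inserted factors. -/
lemma hasSum_exp_mul_exp {R : Type*} [NormedRing R] [NormedAlgebra ℂ R] [CompleteSpace R]
    (A B K : R) (a b : ℂ) :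
    HasSum (fun k : ℕ => ∑ j ∈ Finset.range (k + 1),
        ((k.factorial : ℂ)⁻¹ * ((k.choose j : ℂ) * (a ^ j * b ^ (k - j)))) •
          (A * (K ^ j * B * K ^ (k - j))))
      (A * NormedSpace.exp (a • K) * B * NormedSpace.exp (b • K)) := by
  let _ : NormedAlgebra ℚ R := .restrictScalars ℚ ℂ R
  have hf := NormedSpace.norm_expSeries_summable' (𝕂 := ℂ) (a • K)
  have hg := NormedSpace.norm_expSeries_summable' (𝕂 := ℂ) (b • K)
  have hf' : Summable fun j : ℕ => ‖A * ((j.factorial : ℂ)⁻¹ • (a • K) ^ j) * B‖ := by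
    refine Summable.of_nonneg_of_le (fun _ => norm_nonneg _) (fun j => ?_)
      ((hf.mul_left ‖A‖).mul_right ‖B‖)
    exact (norm_mul_le _ _).trans (mul_le_mul_of_nonneg_right (norm_mul_le _ _) (norm_nonneg _))
  have h := hasSum_sum_range_mul_of_summable_norm hf' hg
  have h1 : ∑' j : ℕ, A * ((j.factorial : ℂ)⁻¹ • (a • K) ^ j) * B =
      A * NormedSpace.exp (a • K) * B := by
    rw [NormedSpace.exp_eq_tsum ℂ]
    rw [(hf.of_norm.mul_left A).tsum_mul_right, hf.of_norm.tsum_mul_left]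
  rw [h1, ← congrFun (NormedSpace.exp_eq_tsum ℂ) (b • K)] at h
  convert h using 1
  refine funext fun k => Finset.sum_congr rfl fun j hj => ?_
  have hjk : j ≤ k := Nat.lt_succ_iff.1 (Finset.mem_range.1 hj)
  have hk : (k.factorial : ℂ) ≠ 0 := by exact_mod_cast k.factorial_ne_zero
  simp only [smul_pow, smul_smul, mul_smul_comm, smul_mul_assoc, mul_assoc]
  congr 1
  -- The binomial coefficient over k! is 1/(j! (k − j)!), the coefficient in the Cauchy product.
  rw [Nat.cast_choose ℂ hjk]
  field_simp

end Exponentials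

/-! ### The Hamiltonian through transition operators, and the Poisson formula -/

section Schwinger

variable {Λ : Type*} [Fintype Λ] [DecidableEq Λ] {G : SimpleGraph Λ} [DecidableRel G.Adj] {n : ℕ}

lemma twoSite_transposition {x y : Λ} (hxy : x ≠ y) :
    (twoSite x y (transposition n) : Op Λ n) = transMat id s(x, y) .cross := by
  ext σ τ
  simp only [twoSite, transposition, transMat, Matrix.of_apply, compat_cross_iff]
  suffices key : ((∀ z, z ≠ x → z ≠ y → σ z = τ z) ∧ σ x = τ y ∧ σ y = τ x) ↔
      σ = τ ∘ Equiv.swap x y by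
    by_cases hc : σ = τ ∘ Equiv.swap x y
    · rw [if_pos hc, if_pos (key.2 hc).1, if_pos (key.2 hc).2]
    · rw [if_neg hc]
      split_ifs with h1 h2
      · exact absurd (key.1 ⟨h1, h2⟩) hc
      · rfl
      · rfl
  constructor
  · rintro ⟨h1, h2, h3⟩
    ext z
    rw [Function.comp_apply]
    by_cases hx : z = x
    · subst hx; rw [Equiv.swap_apply_left, h2]
    by_cases hy : z = y
    · subst hy; rw [Equiv.swap_apply_right, h3]
    rw [Equiv.swap_apply_of_ne_of_ne hx hy, h1 z hx hy]
  · rintro rfl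
    refine ⟨fun z hx hy => ?_, ?_, ?_⟩
    · rw [Function.comp_apply, Equiv.swap_apply_of_ne_of_ne hx hy]
    · simp
    · simp

lemma twoSite_opQ (x y : Λ) :
    (twoSite x y (opQ n) : Op Λ n) = transMat id s(x, y) .bar := by
  ext σ τ
  simp only [twoSite, opQ, transMat, Matrix.of_apply, id,
    compat_bar_iff (ι := (id : Fin (n + 1) → Fin (n + 1))) (fun _ => rfl), @eq_comm _ (σ y),
    @eq_comm _ (τ y)]
  by_cases h1 : ∀ z, z ≠ x → z ≠ y → σ z = τ z
  · simp only [if_pos h1]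
    exact if_congr ⟨fun h => ⟨h1, h⟩, fun h => h.2⟩ rfl rfl
  · rw [if_neg h1, if_neg fun h => h1 h.1]

lemma sum_kind {R : Type*} [AddCommMonoid R] (f : Kind → R) :
    ∑ κ, f κ = f .cross + f .bar := by
  change f .cross + (f .bar + 0) = _
  rw [add_zero]

lemma hamiltonian_eq (u : ℝ) :
    hamiltonian G n u = (G.edgeFinset.card : ℂ) • (1 : Op Λ n) - transSum G n u := by
  have h : ∀ e : G.edgeSet, Sym2.lift ⟨fun x y => pairTerm n u x y, pairTerm_comm n u⟩
      (e : Sym2 Λ) = (u : ℂ) • transMat id (e : Sym2 Λ) .cross +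
        ((1 - u : ℝ) : ℂ) • transMat id (e : Sym2 Λ) .bar - 1 := by
    rintro ⟨e, he⟩
    induction e using Sym2.ind with
    | _ x y =>
      have hxy : x ≠ y := G.ne_of_adj he
      simp only [Sym2.lift_mk, pairTerm, twoSite_transposition hxy, twoSite_opQ]
  rw [hamiltonian, Finset.sum_subtype G.edgeFinset (fun e => SimpleGraph.mem_edgeFinset),
    Finset.sum_congr rfl fun e _ => h e, Finset.sum_sub_distrib, neg_sub, transSum,
    Fintype.sum_prod_type]
  congr 1
  · rw [Finset.sum_const, Finset.card_univ, ← SimpleGraph.card_edgeSet, Nat.cast_smul_eq_nsmul]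
  · refine Finset.sum_congr rfl fun e _ => ?_
    rw [sum_kind]
    rfl

/-- The Hamiltonian is a scalar minus K, and the scalar part commutes with K. -/
lemma exp_smul_hamiltonian (u : ℝ) (z : ℂ) :
    NormedSpace.exp ((-z) • hamiltonian G n u) =
      Complex.exp (-(z * G.edgeFinset.card)) • NormedSpace.exp (z • transSum G n u) := by
  have h1 : (-z) • hamiltonian G n u =
      algebraMap ℂ (Op Λ n) (-(z * G.edgeFinset.card)) + z • transSum G n u := by
    rw [hamiltonian_eq, Algebra.algebraMap_eq_smul_one, smul_sub, smul_smul]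
    module
  rw [h1, Matrix.exp_add_of_commute _ _
    (Algebra.commute_algebraMap_left _ _)]
  have h2 : NormedSpace.exp (algebraMap ℂ (Op Λ n) (-(z * G.edgeFinset.card))) =
      algebraMap ℂ (Op Λ n) (Complex.exp (-(z * G.edgeFinset.card))) := by
    rw [Complex.exp_eq_exp_ℂ]
    open scoped Matrix.Norms.Operator in
    exact (NormedSpace.algebraMap_exp_comm _).symm
  rw [h2, Algebra.algebraMap_eq_smul_one, smul_mul_assoc, one_mul]

variable {β t u : ℝ} {A B : Op Λ n} {F : Config (Transition G) → ℂ}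

/-- The Poisson expansion of the numerator of a Schwinger function. -/
lemma integral_rho (hu : u ∈ Icc (0 : ℝ) 1) (ht : t ∈ Icc 0 β) (hF : IsTraceFunction β t A B F)
    (hint : Integrable F (rho G β u)) :
    ∫ ω, F ω ∂(rho G β u) = (A * NormedSpace.exp ((-(β - t) : ℂ) • hamiltonian G n u) * B *
      NormedSpace.exp ((-t : ℂ) • hamiltonian G n u)).trace := by
  have hβ : 0 ≤ β := ht.1.trans ht.2
  have h1 := hasSum_integral_measure hint
  have h2 : ∀ k : ℕ, ∫ ω, F ω ∂(ENNReal.ofReal (Real.exp (-(intensity G β u univ).toReal) /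
      (k.factorial : ℝ)) • (Measure.pi fun _ : Fin k => intensity G β u).map
        fun p => Config.ofSeq p) = (Real.exp (-(β * G.edgeFinset.card)) : ℂ) *
      Matrix.trace (∑ j ∈ Finset.range (k + 1),
        ((k.factorial : ℂ)⁻¹ * ((k.choose j : ℂ) *
          (((β - t : ℝ) : ℂ) ^ j * (t : ℂ) ^ (k - j)))) •
          (A * (transSum G n u ^ j * B * transSum G n u ^ (k - j)))) := fun k => by
    have hc : 0 < Real.exp (-(intensity G β u univ).toReal) / (k.factorial : ℝ) := by positivity
    have h3 := (integrable_smul_measure (ENNReal.ofReal_pos.2 hc).ne' ENNReal.ofReal_ne_top).1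
      (hint.mono_measure (Measure.le_sum _ k))
    rw [integral_smul_measure, integral_map (measurable_ofSeq k).aemeasurable
      h3.aestronglyMeasurable, integral_ofSeq hu ht hF k (h3.comp_measurable (measurable_ofSeq k)),
      ENNReal.toReal_ofReal hc.le, intensity_univ hu hβ, Complex.real_smul, Matrix.trace_sum,
      Finset.mul_sum, Finset.mul_sum]
    refine Finset.sum_congr rfl fun j _ => ?_
    rw [Matrix.trace_smul, smul_eq_mul]
    push_cast
    ring
  have h4 : HasSum (fun k : ℕ => (Real.exp (-(β * G.edgeFinset.card)) : ℂ) *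
      Matrix.trace (∑ j ∈ Finset.range (k + 1),
        ((k.factorial : ℂ)⁻¹ * ((k.choose j : ℂ) *
          (((β - t : ℝ) : ℂ) ^ j * (t : ℂ) ^ (k - j)))) •
          (A * (transSum G n u ^ j * B * transSum G n u ^ (k - j)))))
      ((Real.exp (-(β * G.edgeFinset.card)) : ℂ) *
        Matrix.trace (A * NormedSpace.exp (((β - t : ℝ) : ℂ) • transSum G n u) * B *
          NormedSpace.exp ((t : ℂ) • transSum G n u))) := by
    open scoped Matrix.Norms.Operator in
    exact ((hasSum_exp_mul_exp A B (transSum G n u) ((β - t : ℝ) : ℂ) (t : ℂ)).map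
      (Matrix.traceAddMonoidHom _ _) (by exact continuous_id.matrix_trace)).mul_left _
  simp only [h2] at h1
  rw [rho, poissonProcess, h1.unique h4, exp_smul_hamiltonian, exp_smul_hamiltonian]
  simp only [mul_smul_comm, smul_mul_assoc, Matrix.trace_smul, smul_eq_mul]
  -- The scalars from the time intervals β − t and t combine into exp(−β|E|).
  rw [← mul_assoc, ← Complex.exp_add]
  push_cast
  congr 2
  ring

end Schwinger


/-! ### The measure of the loop model -/

section LoopModel

variable {Λ : Type*} [Fintype Λ] [DecidableEq Λ] {G : SimpleGraph Λ} {β t u : ℝ} {n : ℕ}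

/-- The event that `(x, 0)` and `(y, t)` belong to the same loop, with the direction `d` at `(y, t)`
relative to the direction at `(x, 0)`. -/
def eventDir (G : SimpleGraph Λ) (β : ℝ) (x y : Λ) (t : ℝ) (d : Dir) :
    Set (Config (Transition G)) :=
  {ω | SameTrajectory β ω ⟨x, 0, .up⟩ ⟨y, t, d⟩}

lemma measurableSet_nice_inter_ncard (hβ : 0 < β) (P : ℕ → Prop) :
    MeasurableSet (niceConfigs G β t ∩ {ω | P (loops β ω).ncard}) :=
  measurableSet_nice_inter β t fun k m m' hm hm' _ _ he hκ _ h => by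
    rw [mem_ofPred_eq, ncard_loops hβ hm] at h
    rwa [mem_ofPred_eq, ncard_loops hβ hm', ← he, ← hκ]

lemma measurableSet_nice_inter_eventDir (hβ : 0 < β) (ht : t ∈ Icc 0 β) (x y : Λ) (d : Dir) :
    MeasurableSet (niceConfigs G β t ∩ eventDir G β x y t d) :=
  measurableSet_nice_inter β t fun k m m' hm hm' hmt hmt' he hκ hs h => by
    rw [eventDir, mem_ofPred_eq, sameTrajectory_zero_iff hβ hm ht hmt] at h
    rwa [eventDir, mem_ofPred_eq, sameTrajectory_zero_iff hβ hm' ht hmt', ← he, ← hκ, ← hs]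

/-- Almost every configuration is nice, so measurability within the nice ones suffices; the raw
events need not be measurable. -/
lemma nullMeasurableSet_of_nice {S : Set (Config (Transition G))}
    (hS : MeasurableSet (niceConfigs G β t ∩ S)) : NullMeasurableSet S (rho G β u) := by
  refine hS.nullMeasurableSet.congr ?_
  filter_upwards [ae_nice (G := G) β u t] with ω hω
  exact propext ⟨fun h => h.2, fun h => ⟨hω, h⟩⟩

/-- The weight `θ ^ |L(ω)|` as a real number, for `θ = n + 1`. -/
def realWeight (n : ℕ) (β : ℝ) (ω : Config (Transition G)) : ℝ :=
  ((n : ℝ) + 1) ^ (loops β ω).ncard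

lemma realWeight_nonneg (ω : Config (Transition G)) : 0 ≤ realWeight n β ω := by
  unfold realWeight
  positivity

lemma loopWeight_eq : loopWeight G β (2 * spin n + 1) =
    fun ω => ENNReal.ofReal (realWeight n β ω) := by
  funext ω
  rw [loopWeight, realWeight, spin, mul_div_cancel₀ _ (two_ne_zero)]

lemma aemeasurable_realWeight (hβ : 0 < β) :
    AEMeasurable (realWeight (G := G) n β) (rho G β u) := by
  classical
  set g : Config (Transition G) → ℕ :=
    fun ω => if ω ∈ niceConfigs G β 0 then (loops β ω).ncard else 0 with hg
  have hgm : Measurable g := by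
    refine measurable_to_countable' fun N => ?_
    -- The count is set to 0 on exceptional configurations, so the fiber over 0 must be handled as a
    -- complement.
    by_cases hN : N = 0
    · subst hN
      convert (measurableSet_nice_inter_ncard (G := G) (t := 0) hβ fun j => j ≠ 0).compl using 1
      ext ω
      simp only [hg, mem_preimage, mem_singleton_iff, mem_compl_iff, mem_inter_iff, mem_ofPred_eq]
      split_ifs <;> simp_all
    · convert measurableSet_nice_inter_ncard (G := G) (t := 0) hβ fun j => j = N using 1
      ext ω
      simp only [hg, mem_preimage, mem_singleton_iff, mem_inter_iff, mem_ofPred_eq]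
      split_ifs <;> simp_all [eq_comm]
  refine ⟨fun ω => ((n : ℝ) + 1) ^ g ω, (measurable_from_nat
    (f := fun j : ℕ => ((n : ℝ) + 1) ^ j)).comp hgm, ?_⟩
  filter_upwards [ae_nice (G := G) β u 0] with ω hω
  simp only [realWeight, hg, if_pos hω]

/-- Every loop contains one of the |Λ|(k + 1) slices. -/
lemma ae_ncard_le (hβ : 0 < β) (k : ℕ) :
    ∀ᵐ ω ∂((Measure.pi fun _ : Fin k => intensity G β u).map fun p => Config.ofSeq p),
      (loops β ω).ncard ≤ Fintype.card Λ * (k + 1) := by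
  have hm := measurableSet_nice_inter_ncard (G := G) (t := 0) hβ
    fun j => j ≤ Fintype.card Λ * (k + 1)
  have h1 : ∀ᵐ p ∂(Measure.pi fun _ : Fin k => intensity G β u), Config.ofSeq p ∈
      niceConfigs G β 0 ∩ {ω | (loops β ω).ncard ≤ Fintype.card Λ * (k + 1)} := by
    refine ae_withTimes (measurable_ofSeq k hm) ?_
    filter_upwards [ae_goodTimes β 0 k] with s hs f
    obtain ⟨π, hπ⟩ := hs.exists_sort (G := G)
    refine ⟨⟨k, _, (hπ f).1, fun i => hs.ne _, (hπ f).2⟩, ?_⟩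
    rw [mem_ofPred_eq, ← (hπ f).2, ncard_loops hβ (hπ f).1]
    refine (Nat.card_le_card_of_surjective _ Quotient.mk_surjective).trans ?_
    simp
  have h2 := (ae_map_iff (measurable_ofSeq k).aemeasurable hm).2 h1
  filter_upwards [h2] with ω hω using hω.2

/-- The number of loops grows at most linearly in the number k of transitions, so the weight grows
geometrically and is beaten by 1/k!. -/
lemma lintegral_realWeight_ne_top (hβ : 0 < β) :
    ∫⁻ ω, ENNReal.ofReal (realWeight n β ω) ∂(rho G β u) ≠ ⊤ := by
  set ν := intensity G β u
  set L := Fintype.card Λ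
  set c : ℕ → ℝ := fun k => Real.exp (-(ν univ).toReal) / (k.factorial : ℝ) with hc
  have hc0 : ∀ k, 0 ≤ c k := fun k => by positivity
  have hbound : ∀ k : ℕ, ∫⁻ ω, ENNReal.ofReal (realWeight n β ω) ∂(ENNReal.ofReal (c k) •
      (Measure.pi fun _ : Fin k => ν).map fun p => Config.ofSeq p) ≤
      ENNReal.ofReal (Real.exp (-(ν univ).toReal) * ((n : ℝ) + 1) ^ L *
        ((((n : ℝ) + 1) ^ L * (ν univ).toReal) ^ k / (k.factorial : ℝ))) := fun k => by
    rw [lintegral_smul_measure, smul_eq_mul]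
    have h1 : ∫⁻ ω, ENNReal.ofReal (realWeight n β ω)
        ∂((Measure.pi fun _ : Fin k => ν).map fun p => Config.ofSeq p) ≤
        ENNReal.ofReal (((n : ℝ) + 1) ^ (L * (k + 1)) * (ν univ).toReal ^ k) := by
      refine (lintegral_mono_ae (g := fun _ => ENNReal.ofReal (((n : ℝ) + 1) ^ (L * (k + 1))))
        ?_).trans ?_
      · filter_upwards [ae_ncard_le (G := G) (u := u) hβ k] with ω hω
        exact ENNReal.ofReal_le_ofReal (pow_le_pow_right₀ (by simp) hω)
      · rw [lintegral_const, Measure.map_apply (measurable_ofSeq k) MeasurableSet.univ,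
          preimage_univ, Measure.pi_univ, Finset.prod_const, Finset.card_univ, Fintype.card_fin,
          ENNReal.ofReal_mul (by positivity), ENNReal.ofReal_pow ENNReal.toReal_nonneg,
          ENNReal.ofReal_toReal (measure_ne_top _ _)]
    refine (mul_le_mul_right h1 _).trans ?_
    rw [← ENNReal.ofReal_mul (hc0 k)]
    refine ENNReal.ofReal_le_ofReal (le_of_eq ?_)
    rw [hc, mul_pow, ← pow_mul]
    ring
  rw [rho, poissonProcess, lintegral_sum_measure]
  refine ne_top_of_le_ne_top ?_ (ENNReal.tsum_le_tsum hbound)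
  exact ((Real.summable_pow_div_factorial _).mul_left _).tsum_ofReal_ne_top

lemma integrable_realWeight (hβ : 0 < β) :
    Integrable (realWeight (G := G) n β) (rho G β u) :=
  (lintegral_ofReal_ne_top_iff_integrable (aemeasurable_realWeight hβ).aestronglyMeasurable
    (Filter.Eventually.of_forall realWeight_nonneg)).1 (lintegral_realWeight_ne_top hβ)

instance : SFinite (rho G β u) := by
  unfold rho poissonProcess
  infer_instance

lemma loopMeasure_real (hβ : 0 < β) (S : Set (Config (Transition G))) :
    (loopMeasure G β u (2 * spin n + 1)).real S =
      (∫ ω, realWeight n β ω ∂(rho G β u))⁻¹ * ∫ ω in S, realWeight n β ω ∂(rho G β u) := by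
  have hw := (integrable_realWeight (G := G) (n := n) (u := u) hβ).aestronglyMeasurable
  rw [measureReal_def, loopMeasure, Measure.smul_apply, withDensity_apply', smul_eq_mul,
    ENNReal.toReal_mul, ENNReal.toReal_inv, loopWeight_eq,
    integral_eq_lintegral_of_nonneg_ae (Filter.Eventually.of_forall realWeight_nonneg) hw,
    integral_eq_lintegral_of_nonneg_ae (Filter.Eventually.of_forall realWeight_nonneg)
      hw.restrict]

lemma aedisjoint_eventDir (hβ : 0 < β) (ht : t ∈ Icc 0 β) (x y : Λ) :
    AEDisjoint (rho G β u) (eventDir G β x y t .up) (eventDir G β x y t .down) := by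
  have h : ∀ᵐ ω ∂(rho G β u), ¬ (ω ∈ eventDir G β x y t .up ∩ eventDir G β x y t .down) := by
    filter_upwards [ae_nice (G := G) β u t] with ω hω
    obtain ⟨k, m, hm, hmt, rfl⟩ := hω
    rintro ⟨h1, h2⟩
    have h3 := (sameTrajectory_zero_iff hβ hm ht hmt .up).1 h1
    have h4 := (sameTrajectory_zero_iff hβ hm ht hmt .down).1 h2
    exact absurd (h3.dir_eq (edgesOf_not_isDiag m) h4) (by simp)
  rw [ae_iff] at h
  have h' : (rho G β u) (eventDir G β x y t .up ∩ eventDir G β x y t .down) = 0 := by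
    simpa only [not_not, ofPred_mem_eq] using h
  exact h'

lemma loopMeasure_real_eventSame (hβ : 0 < β) (ht : t ∈ Icc 0 β) (x y : Λ) :
    (loopMeasure G β u (2 * spin n + 1)).real (eventSame G β x y t) =
      (loopMeasure G β u (2 * spin n + 1)).real (eventPlus G β x y t) +
        (loopMeasure G β u (2 * spin n + 1)).real (eventMinus G β x y t) := by
  have hw := integrable_realWeight (G := G) (n := n) (u := u) hβ
  simp only [loopMeasure_real hβ]
  rw [← mul_add]
  congr 1
  exact setIntegral_union₀ (aedisjoint_eventDir hβ ht x y)
    (nullMeasurableSet_of_nice (measurableSet_nice_inter_eventDir hβ ht x y .down))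
    hw.integrableOn hw.integrableOn

variable [DecidableRel G.Adj]

/-- This is the Poisson expansion with both insertions equal to 1 and t = 0. The site `x` only
witnesses that the lattice is nonempty. -/
lemma trace_exp_hamiltonian (hβ : 0 < β) (hu : u ∈ Icc (0 : ℝ) 1) (x : Λ) :
    (NormedSpace.exp ((-β : ℂ) • hamiltonian G n u)).trace =
      ((∫ ω, realWeight n β ω ∂(rho G β u) : ℝ) : ℂ) := by
  have hF : IsTraceFunction β 0 (1 : Op Λ n) 1
      fun ω : Config (Transition G) => (realWeight n β ω : ℂ) := fun k m hm _ => by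
    rw [trace_prod_transMat (edgesOf_not_isDiag m) x]
    simp only [realWeight, ncard_loops hβ hm]
    push_cast
    rfl
  have h := integral_rho hu ⟨le_rfl, hβ.le⟩ hF (integrable_realWeight hβ).ofReal
  rw [integral_complex_ofReal] at h
  rw [h]
  simp

/-- The hypothesis `hA` is the combinatorial result for one sequence of transitions; integrating it
against ρ_u and dividing by the partition function gives loop probabilities. -/
lemma schwinger_eq (hβ : 0 < β) (hu : u ∈ Icc (0 : ℝ) 1) (ht : t ∈ Icc 0 β) (x y : Λ)
    (A : Matrix (Fin (n + 1)) (Fin (n + 1)) ℂ) (c η : ℝ)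
    (hA : ∀ (k : ℕ) (e : Fin k → Sym2 Λ) (κ : Fin k → Kind) (l : Fin (k + 1)),
      (∀ i, ¬ (e i).IsDiag) → insertTrace n e κ x y l A A =
        (c : ℂ) * (connSign e κ η (x, 0) (y, l) * ((n : ℂ) + 1) ^ Nat.card (LoopQuot e κ))) :
    schwinger (hamiltonian G n u) β (oneSite x A) (oneSite y A) t =
      ((c * ((loopMeasure G β u (2 * spin n + 1)).real (eventPlus G β x y t) +
        η * (loopMeasure G β u (2 * spin n + 1)).real (eventMinus G β x y t)) : ℝ) : ℂ) := by
  classical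
  have hw := integrable_realWeight (G := G) (n := n) (u := u) hβ
  set W : Dir → Config (Transition G) → ℝ :=
    fun d => (eventDir G β x y t d).indicator (realWeight n β)
  have hnull : ∀ d, NullMeasurableSet (eventDir G β x y t d) (rho G β u) := fun d =>
    nullMeasurableSet_of_nice (measurableSet_nice_inter_eventDir hβ ht x y d)
  have hWint : ∀ d, Integrable (W d) (rho G β u) := fun d =>
    hw.indicator₀ (hnull d)
  have hF : IsTraceFunction β t (oneSite x A : Op Λ n) (oneSite y A)
      fun ω : Config (Transition G) => ((c * (W .up ω + η * W .down ω) : ℝ) : ℂ) := by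
    intro k m hm hmt
    refine Eq.trans ?_ (hA k (edgesOf m) (kindsOf m) (slice m t) (edgesOf_not_isDiag m)).symm
    have hW : ∀ d, W d (Config.ofSeq m) =
        (if Conn (edgesOf m) (kindsOf m) ((x, 0), .up) ((y, slice m t), d) then 1 else 0) *
          ((n : ℝ) + 1) ^ Nat.card (LoopQuot (edgesOf m) (kindsOf m)) := fun d => by
      have h1 : Config.ofSeq m ∈ eventDir G β x y t d ↔
          Conn (edgesOf m) (kindsOf m) ((x, 0), .up) ((y, slice m t), d) :=
        sameTrajectory_zero_iff hβ hm ht hmt d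
      simp only [W, indicator_apply, h1, realWeight, ncard_loops hβ hm]
      split_ifs <;> simp
    simp only [hW, connSign]
    split_ifs <;> push_cast <;> ring
  have hint : Integrable (fun ω => c * (W .up ω + η * W .down ω)) (rho G β u) :=
    ((hWint _).add ((hWint _).const_mul _)).const_mul _
  have h := integral_rho hu ht hF hint.ofReal
  rw [schwinger, ← h, trace_exp_hamiltonian hβ hu x]
  rw [integral_complex_ofReal, ← Complex.ofReal_div, loopMeasure_real hβ, loopMeasure_real hβ,
    integral_const_mul, integral_add (hWint _) ((hWint _).const_mul _), integral_const_mul,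
    integral_indicator₀ (hnull _), integral_indicator₀ (hnull _)]
  simp only [eventDir, eventPlus, eventMinus]
  congr 1
  ring

end LoopModel

end LoopSpin

end

/-! ### The three correlation formulas -/

theorem mainTheorem6 {Λ : Type*} [Fintype Λ] [DecidableEq Λ]
    (G : SimpleGraph Λ) [DecidableRel G.Adj]
    (β u : ℝ) (hβ : 0 < β) (hu : u ∈ Set.Icc (0 : ℝ) 1)
    (n : ℕ) (x y : Λ) (t : ℝ) (ht : t ∈ Set.Icc 0 β) :
    LoopSpin.schwinger (LoopSpin.hamiltonian G n u) β
        (LoopSpin.oneSite x (LoopSpin.spin1 n)) (LoopSpin.oneSite y (LoopSpin.spin1 n)) t =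
      ((1 / 3 * LoopSpin.spin n * (LoopSpin.spin n + 1) *
        (LoopSpin.loopMeasure G β u (2 * LoopSpin.spin n + 1)).real
          (LoopSpin.eventSame G β x y t) : ℝ) : ℂ) ∧
    LoopSpin.schwinger (LoopSpin.hamiltonian G n u) β
        (LoopSpin.oneSite x (LoopSpin.spin3 n)) (LoopSpin.oneSite y (LoopSpin.spin3 n)) t =
      ((1 / 3 * LoopSpin.spin n * (LoopSpin.spin n + 1) *
        (LoopSpin.loopMeasure G β u (2 * LoopSpin.spin n + 1)).real
          (LoopSpin.eventSame G β x y t) : ℝ) : ℂ) ∧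
    LoopSpin.schwinger (LoopSpin.hamiltonian G n u) β
        (LoopSpin.oneSite x (LoopSpin.spin2 n)) (LoopSpin.oneSite y (LoopSpin.spin2 n)) t =
      ((1 / 3 * LoopSpin.spin n * (LoopSpin.spin n + 1) *
        ((LoopSpin.loopMeasure G β u (2 * LoopSpin.spin n + 1)).real
            (LoopSpin.eventPlus G β x y t) -
          (LoopSpin.loopMeasure G β u (2 * LoopSpin.spin n + 1)).real
            (LoopSpin.eventMinus G β x y t)) : ℝ) : ℂ) := by
  refine ⟨?_, ?_, ?_⟩
  -- Here η = 1, and the probabilities of E⁺ and E⁻ add up to that of E by almost sure disjointness.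
  · rw [LoopSpin.schwinger_eq hβ hu ht x y (LoopSpin.spin1 n)
      (1 / 3 * LoopSpin.spin n * (LoopSpin.spin n + 1)) 1 fun k e κ l he => by
        simpa using LoopSpin.insertTrace_spin1 he x y l,
      LoopSpin.loopMeasure_real_eventSame hβ ht, one_mul]
  · rw [LoopSpin.schwinger_eq hβ hu ht x y (LoopSpin.spin3 n)
      (1 / 3 * LoopSpin.spin n * (LoopSpin.spin n + 1)) 1 fun k e κ l he => by
        simpa using LoopSpin.insertTrace_spin3 he x y l,
      LoopSpin.loopMeasure_real_eventSame hβ ht, one_mul]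
  · rw [LoopSpin.schwinger_eq hβ hu ht x y (LoopSpin.spin2 n)
      (1 / 3 * LoopSpin.spin n * (LoopSpin.spin n + 1)) (-1) fun k e κ l he => by
        simpa using LoopSpin.insertTrace_spin2 he x y l,
      neg_one_mul, ← sub_eq_add_neg]
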